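/- Let $\mathbb{F}_q$ be a finite field. For $n\ge 0$ let $\mathfrak{gl}_n(\mathbb{F}_q)$ be the space of $n\times n$ matrices (so $\mathfrak{gl}_0(\mathbb{F}_q)=\{0\}$), and let $C(\mathfrak{gl}_n(\mathbb{F}_q))$ be the complex vector space of functions $f\colon\mathfrak{gl}_n(\mathbb{F}_q)\to\mathbb{C}$ with $f(gxg^{-1})=f(x)$ for all $g\in\mathrm{GL}_n(\mathbb{F}_q)$ and all $x$ (so $C(\mathfrak{gl}_0(\mathbb{F}_q))=\mathbb{C}$). **Harish-Chandra induction.** For positive integers $k,l$, view $\mathfrak{gl}_k\times\mathfrak{gl}_l$ as the block-diagonal matrices in $\mathfrak{gl}_{k+l}$. Let $P\subseteq\mathrm{GL}_{k+l}(\mathbb{F}_q)$ and $\mathcal{P}\subseteq\mathfrak{gl}_{k+l}(\mathbb{F}_q)$ consist of the block upper triangular matrices, and let $\pi\colon\mathcal{P}\to\mathfrak{gl}_k(\mathbb{F}_q)\times\mathfrak{gl}_l(\mathbb{F}_q)$ be the projection to the diagonal blocks. For $f_1\in C(\mathfrak{gl}_k(\mathbb{F}_q))$ and $f_2\in C(\mathfrak{gl}_l(\mathbb{F}_q))$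 put $(f_1\boxtimes f_2)(x,y)=f_1(x)f_2(y)$ and $$R_{k,l}^{k+l}(f_1\boxtimes f_2)(x)=\frac{1}{|P|}\sum_{\substack{g\in\mathrm{GL}_{k+l}(\mathbb{F}_q)\\ gxg^{-1}\in\mathcal{P}}}(f_1\boxtimes f_2)\bigl(\pi(gxg^{-1})\bigr)\in C(\mathfrak{gl}_{k+l}(\mathbb{F}_q)).$$ **Pre-cuspidal functions.** Let $P$ be a proper parabolic subgroup of $\mathrm{GL}_n$ with a Levi subgroup $L$, both defined over $\mathbb{F}_q$; that is, $P$ is the stabilizer of the flag $W_1\subset W_1\oplus W_2\subset\cdots$ and $L$ is the stabilizer of the decomposition, for some decomposition $\mathbb{F}_q^n=W_1\oplus\cdots\oplus W_r$ into $r\ge 2$ nonzero subspaces. Let $\mathcal{L}$ be the set of $\mathbb{F}_q$-points of the Lie algebra of $L$, let $U$ be the group of $\mathbb{F}_q$-points of the unipotent radical of $P$, and let $\mathcal{U}$ be the set of $\mathbb{F}_q$-points of its Lie algebra. The Harish-Chandra restriction of $f\in C(\mathfrak{gl}_n(\mathbb{F}_q))$ to $\mathcal{L}$ is the function $${}^*R(f)(x)=\frac{1}{|U|}\sum_{y\in\mathcal{U}}f(x+y)\qquad(x\in\mathcal{L}).$$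 Call $f$ *pre-cuspidal* if ${}^*R(f)=0$ for all such pairs $(P,L)$. **Theorem.** There exists a unique collection $\{\mathbb{D}_n\}_{n\ge 0}$ of $\mathbb{C}$-linear endomorphisms $\mathbb{D}_n$ of $C(\mathfrak{gl}_n(\mathbb{F}_q))$, one for each $n\ge 0$, such that (i) $\mathbb{D}_0=\mathrm{id}$, and for all positive integers $n_1,n_2$ and all $f_i\in C(\mathfrak{gl}_{n_i}(\mathbb{F}_q))$ ($i=1,2$), $$\mathbb{D}_{n_1+n_2}\bigl(R_{n_1,n_2}^{n_1+n_2}(f_1\boxtimes f_2)\bigr)=R_{n_1,n_2}^{n_1+n_2}\bigl(\mathbb{D}_{n_1}(f_1)\boxtimes\mathbb{D}_{n_2}(f_2)\bigr);$$ (ii) $\mathbb{D}_n(f)=(-1)^{n-1}f$ for every $n\ge 1$ and every pre-cuspidal $f\in C(\mathfrak{gl}_n(\mathbb{F}_q))$. -/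

import Mathlib

/-- `C(𝔤𝔩ₙ(F))`: the complex vector space of functions `𝔤𝔩ₙ(F) → ℂ` that are invariant under the
adjoint action of `GLₙ(F)`. -/
def InvFun (F : Type*) [Field F] (n : ℕ) : Submodule ℂ (Matrix (Fin n) (Fin n) F → ℂ) where
  carrier := {f | ∀ (g : GL (Fin n) F) (x : Matrix (Fin n) (Fin n) F),
    f (g.val * x * g⁻¹.val) = f x}
  add_mem' := fun ha hb g x => congrArg₂ (· + ·) (ha g x) (hb g x)
  zero_mem' := fun _ _ => rfl
  smul_mem' := fun c _ ha g x => congrArg (c * ·) (ha g x)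

/-- `C(𝔤𝔩ₖ(F) × 𝔤𝔩ₗ(F))`: the invariant functions on the Lie algebra of the block-diagonal Levi
subgroup `GLₖ × GLₗ` of `GL₍ₖ₊ₗ₎`; the pair `(x, y)` stands for the block matrix `diag(x, y)`. -/
def LeviInvFun (F : Type*) [Field F] (k l : ℕ) :
    Submodule ℂ (Matrix (Fin k) (Fin k) F × Matrix (Fin l) (Fin l) F → ℂ) where
  carrier := {f | ∀ (g : GL (Fin k) F) (h : GL (Fin l) F)
    (x : Matrix (Fin k) (Fin k) F) (y : Matrix (Fin l) (Fin l) F),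
    f (g.val * x * g⁻¹.val, h.val * y * h⁻¹.val) = f (x, y)}
  add_mem' := fun ha hb g h x y => congrArg₂ (· + ·) (ha g h x y) (hb g h x y)
  zero_mem' := fun _ _ _ _ => rfl
  smul_mem' := fun c _ ha g h x y => congrArg (c * ·) (ha g h x y)

/-- The exterior product `(f₁ ⊠ f₂)(x, y) = f₁(x) f₂(y)`. -/
def boxProd {F : Type*} [Field F] {k l : ℕ} (f₁ : InvFun F k) (f₂ : InvFun F l) :
    LeviInvFun F k l :=
  ⟨fun p => f₁.1 p.1 * f₂.1 p.2, fun g h x y => by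
    simp only [f₁.2 g x, f₂.2 h y]⟩

/-- The standard parabolic subalgebra of `𝔤𝔩₍ₖ₊ₗ₎(F)` whose Levi subalgebra is `𝔤𝔩ₖ × 𝔤𝔩ₗ`
(block-diagonal matrices): the block upper triangular matrices, i.e. those whose lower left
`l × k` block vanishes. -/
def stdParabolic (F : Type*) [Field F] (k l : ℕ) :
    Set (Matrix (Fin (k + l)) (Fin (k + l)) F) :=
  {x | ∀ (i : Fin l) (j : Fin k), x (Fin.natAdd k i) (Fin.castAdd l j) = 0}

/-- The projection of the standard parabolic subalgebra onto its Levi subalgebra `𝔤𝔩ₖ × 𝔤𝔩ₗ`: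
take the two diagonal blocks. -/
def stdLeviProj {F : Type*} [Field F] {k l : ℕ} (x : Matrix (Fin (k + l)) (Fin (k + l)) F) :
    Matrix (Fin k) (Fin k) F × Matrix (Fin l) (Fin l) F :=
  (x.submatrix (Fin.castAdd l) (Fin.castAdd l), x.submatrix (Fin.natAdd k) (Fin.natAdd k))

open scoped Classical in
/-- Harish-Chandra induction from the block-diagonal Levi subalgebra `𝔤𝔩ₖ × 𝔤𝔩ₗ` to `𝔤𝔩₍ₖ₊ₗ₎`:
`R(f)(x) = |P|⁻¹ ∑ f(π(g x g⁻¹))`, the sum being over all `g ∈ GL₍ₖ₊ₗ₎(F)` such that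
`g x g⁻¹` lies in the parabolic subalgebra. -/
noncomputable def hcInd {F : Type*} [Field F] [Fintype F] {k l : ℕ} (f : LeviInvFun F k l) :
    InvFun F (k + l) :=
  ⟨fun x => (Nat.card {g : GL (Fin (k + l)) F // g.val ∈ stdParabolic F k l} : ℂ)⁻¹ *
      ∑ g : GL (Fin (k + l)) F with g.val * x * g⁻¹.val ∈ stdParabolic F k l,
        f.1 (stdLeviProj (g.val * x * g⁻¹.val)), fun h x => by
    beta_reduce
    congr 1
    rw [Finset.sum_filter, Finset.sum_filter]
    refine Fintype.sum_equiv (Equiv.mulRight h) _ _ fun g => ?_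
    simp only [Equiv.coe_mulRight, mul_inv_rev, Units.val_mul, mul_assoc]⟩

/-- An ordered decomposition `Fⁿ = W₀ ⊕ ⋯ ⊕ W₍ᵣ₋₁₎` into nonzero subspaces. Such decompositions
describe the pairs (parabolic subgroup `P`, Levi subgroup `L` of `P`) of `GLₙ` that are defined
over `F`: `P` is the stabilizer of the flag `W₀ ⊂ W₀ ⊕ W₁ ⊂ ⋯`, and `L` is the stabilizer of the
decomposition. The parabolic subgroup is proper if and only if `2 ≤ r`. -/
structure LeviDecomposition (F : Type*) [Field F] (n r : ℕ) where
  /-- the summands -/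
  W : Fin r → Submodule F (Fin n → F)
  ne_bot : ∀ i, W i ≠ ⊥
  isInternal : DirectSum.IsInternal W

namespace LeviDecomposition

variable {F : Type*} [Field F] {n r : ℕ}

/-- The Lie algebra of the Levi subgroup: the matrices that map each summand to itself. -/
def levi (D : LeviDecomposition F n r) : Set (Matrix (Fin n) (Fin n) F) :=
  {x | ∀ i, ∀ v ∈ D.W i, x.mulVec v ∈ D.W i}

/-- The nilradical of the parabolic subalgebra: the matrices that map each member
`⨁_{j ≤ i} W j` of the flag into the preceding one, `⨁_{j < i} W j`. -/
def nilradical (D : LeviDecomposition F n r) : Set (Matrix (Fin n) (Fin n) F) :=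
  {x | ∀ i, ∀ v ∈ (⨆ j ≤ i, D.W j), x.mulVec v ∈ (⨆ j < i, D.W j)}

/-- The unipotent radical of the parabolic subgroup: the invertible matrices that act trivially
on each successive quotient of the flag. -/
def unipotentRadical (D : LeviDecomposition F n r) : Set (GL (Fin n) F) :=
  {u | u.val - 1 ∈ D.nilradical}

open scoped Classical in
/-- Harish-Chandra restriction of a function on `𝔤𝔩ₙ(F)`:
`*R(f)(x) = |U|⁻¹ ∑ f(x + y)` for `x` in the Levi subalgebra, the sum being over the nilradical
of the parabolic subalgebra, where `U` is the unipotent radical of the parabolic subgroup. -/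
noncomputable def hcRes [Fintype F] (D : LeviDecomposition F n r) (f : InvFun F n) :
    D.levi → ℂ :=
  fun x => (Nat.card D.unipotentRadical : ℂ)⁻¹ *
    ∑ y : Matrix (Fin n) (Fin n) F with y ∈ D.nilradical, f.1 (x.1 + y)

end LeviDecomposition

/-- An invariant function is pre-cuspidal if its Harish-Chandra restriction to the Lie algebra of
every Levi subgroup of every proper parabolic subgroup (all defined over `F`) vanishes. -/
def IsPreCuspidal {F : Type*} [Field F] [Fintype F] {n : ℕ} (f : InvFun F n) : Prop :=
  ∀ r : ℕ, 2 ≤ r → ∀ D : LeviDecomposition F n r, D.hcRes f = 0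

/-! Harish-Chandra induction (`hcProd`) makes the sum of the spaces C(gl_n) an algebra. Its
indecomposables are the pre-cuspidal functions: by Frobenius reciprocity
(`isPreCuspidal_iff_pairing`) these are exactly the functions orthogonal to all products of positive
degree under the form ∑ f g. Since ∑ |f|² is positive definite, every function is a pre-cuspidal one
plus a combination of such products (`exists_isPreCuspidal_add`). Uniqueness follows by induction on
the degree. So does the fact that words in pre-cuspidal letters span.

For existence, the operator has to multiply a word of r letters in degree n by (-1)^(n-r). This is
well defined as soon as words with an even number of letters and words with an odd number span
complementary subspaces (`isCompl_signPart`). Both spans are stable under complex conjugation, so by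
positivity it is enough that they are orthogonal (`pairing_signPart_eq_zero`).

Orthogonality is proved by induction on n through a Mackey-type computation of the pairing of p·g
with r·h, where p and r are pre-cuspidal. The Bruhat decomposition reduces it to pairs of coordinate
subspaces S, S'. If the intersection is nonempty and proper in S or in S', cuspidality of p or r
kills the term. If S = S', the pairing of g with h factors out. If S and S' are disjoint, the term
is the pairing of `skew z r g` with `skew z p h`. Being adjoint to multiplication by one letter,
`skew` reverses parity, so words of opposite parity lead again to elements of opposite parity in
smaller degree.

Since only vanishing and spans matter, every normalising constant is left as an unspecified scalar,
nonzero where it has to be cancelled. -/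

section

open scoped Classical

/-! ### Invariant functions on matrices with arbitrary index types, and the bilinear pairing -/

/-- Invariant functions are unaffected by simultaneous permutations of rows and columns. -/
theorem InvFun.apply_submatrix_perm {F : Type*} [Field F] {n : ℕ} (f : InvFun F n)
    (σ : Equiv.Perm (Fin n)) (x : Matrix (Fin n) (Fin n) F) :
    f.1 (x.submatrix σ σ) = f.1 x := by
  have h1 : (σ.toPEquiv.toMatrix : Matrix (Fin n) (Fin n) F) * σ.symm.toPEquiv.toMatrix = 1 := by
    rw [← PEquiv.toMatrix_trans, ← Equiv.toPEquiv_trans]; simp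
  have h2 : (σ.symm.toPEquiv.toMatrix : Matrix (Fin n) (Fin n) F) * σ.toPEquiv.toMatrix = 1 := by
    rw [← PEquiv.toMatrix_trans, ← Equiv.toPEquiv_trans]; simp
  have := f.2 ⟨σ.toPEquiv.toMatrix, σ.symm.toPEquiv.toMatrix, h1, h2⟩ x
  rw [← this]
  simp only [Units.inv_mk]
  rw [PEquiv.toMatrix_toPEquiv_mul, PEquiv.mul_toMatrix_toPEquiv]
  simp [Matrix.submatrix_submatrix]

/-- The value of an invariant function on a square matrix with arbitrary index type. -/
noncomputable def InvFun.ev {F : Type*} [Field F] {n : ℕ} (f : InvFun F n) {ι : Type*}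
    (x : Matrix ι ι F) : ℂ :=
  -- The value 0 for an index type of the wrong size lets `ev_submatrix` and `ev_conj` hold without
  -- a cardinality hypothesis.
  if h : Nonempty (ι ≃ Fin n) then f.1 (x.submatrix h.some.symm h.some.symm) else 0

namespace InvFun

variable {F : Type*} [Field F] {n : ℕ}

/-- Two enumerations of the index set differ by a permutation matrix, which conjugation invariance
absorbs. -/
theorem ev_eq (f : InvFun F n) {ι : Type*} (e : ι ≃ Fin n) (x : Matrix ι ι F) :
    ev f x = f.1 (x.submatrix e.symm e.symm) := by
  have h : Nonempty (ι ≃ Fin n) := ⟨e⟩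
  rw [ev, dif_pos h, ← apply_submatrix_perm f (e.symm.trans h.some)]
  rw [Matrix.submatrix_submatrix]
  refine congrArg f.1 (Matrix.ext fun i j => ?_)
  simp

theorem ev_fin (f : InvFun F n) (x : Matrix (Fin n) (Fin n) F) : ev f x = f.1 x := by
  rw [ev_eq f (Equiv.refl _)]; rfl

theorem ev_submatrix (f : InvFun F n) {ι κ : Type*} (e : κ ≃ ι) (x : Matrix ι ι F) :
    ev f (x.submatrix e e) = ev f x := by
  by_cases h : Nonempty (ι ≃ Fin n)
  · obtain ⟨d⟩ := h
    rw [ev_eq f d, ev_eq f (e.trans d), Matrix.submatrix_submatrix]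
    refine congrArg f.1 (Matrix.ext fun i j => ?_)
    simp
  · have h' : ¬ Nonempty (κ ≃ Fin n) := fun ⟨d⟩ => h ⟨e.symm.trans d⟩
    rw [ev, ev, dif_neg h, dif_neg h']

theorem ev_conj (f : InvFun F n) {ι : Type*} [Fintype ι] [DecidableEq ι] (a b : Matrix ι ι F)
    (hab : a * b = 1) (x : Matrix ι ι F) : ev f (a * x * b) = ev f x := by
  by_cases h : Nonempty (ι ≃ Fin n)
  · obtain ⟨d⟩ := h
    rw [ev_eq f d, ev_eq f d]
    have hab' : a.submatrix d.symm d.symm * b.submatrix d.symm d.symm = 1 := by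
      rw [Matrix.submatrix_mul_equiv, hab, Matrix.submatrix_one_equiv]
    have := f.2 ⟨_, _, hab', mul_eq_one_comm.1 hab'⟩ (x.submatrix d.symm d.symm)
    rw [← this]
    simp only [Units.inv_mk, Matrix.submatrix_mul_equiv]
  · rw [ev, ev, dif_neg h, dif_neg h]

theorem ev_smul (c : ℂ) (f : InvFun F n) {ι : Type*} (x : Matrix ι ι F) :
    ev (c • f) x = c * ev f x := by
  unfold ev; split_ifs <;> simp

/-- Complex conjugation on invariant functions. -/
noncomputable def conj (f : InvFun F n) : InvFun F n :=
  ⟨fun x => star (f.1 x), fun g x => congrArg star (f.2 g x)⟩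

variable [Fintype F]

/-- The bilinear form `(f, g) ↦ ∑ f(x) g(x)` on invariant functions. -/
noncomputable def pairing (F : Type*) [Field F] [Fintype F] (n : ℕ) :
    LinearMap.BilinForm ℂ (InvFun F n) :=
  LinearMap.mk₂ ℂ (fun f g => ∑ x, f.1 x * g.1 x)
    (fun f f' g => by simp [add_mul, Finset.sum_add_distrib])
    (fun c f g => by simp [mul_assoc, Finset.mul_sum])
    (fun f g g' => by simp [mul_add, Finset.sum_add_distrib])
    (fun c f g => by simp [mul_left_comm, Finset.mul_sum])

theorem pairing_apply (f g : InvFun F n) : pairing F n f g = ∑ x, f.1 x * g.1 x := rfl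

theorem pairing_comm (f g : InvFun F n) : pairing F n f g = pairing F n g f := by
  simp only [pairing_apply, mul_comm]

theorem pairing_eq_sum_ev (f g : InvFun F n) {ι : Type*} [Fintype ι] [DecidableEq ι]
    (e : ι ≃ Fin n) : pairing F n f g = ∑ x : Matrix ι ι F, ev f x * ev g x := by
  rw [pairing_apply]
  refine (Fintype.sum_equiv (Matrix.reindex e e) _ _ fun x => ?_).symm
  rw [ev_eq f e, ev_eq g e]; rfl

/-- The sum is ∑ |f|². This is the only positivity input: it makes a conjugation-stable subspace
meet its orthogonal trivially, although the form is bilinear and not Hermitian. -/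
theorem eq_zero_of_pairing_conj (f : InvFun F n) (h : pairing F n f (conj f) = 0) : f = 0 := by
  rw [pairing_apply] at h
  have h1 : ∑ x, ((Complex.normSq (f.1 x) : ℝ) : ℂ) = 0 := by
    rw [← h]; exact Finset.sum_congr rfl fun x _ => (Complex.mul_conj _).symm
  rw [← Complex.ofReal_sum, Complex.ofReal_eq_zero,
    Finset.sum_eq_zero_iff_of_nonneg fun _ _ => Complex.normSq_nonneg _] at h1
  ext x
  exact Complex.normSq_eq_zero.1 (h1 x (Finset.mem_univ x))

theorem eq_of_pairing {f g : InvFun F n} (h : ∀ φ, pairing F n f φ = pairing F n g φ) : f = g := by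
  rw [← sub_eq_zero]
  apply eq_zero_of_pairing_conj
  rw [map_sub, LinearMap.sub_apply, h, sub_self]

end InvFun

/-! ### Block upper triangular matrices for an arbitrary subset of the indices -/

namespace Matrix

variable {R ι : Type*} [CommRing R]

/-- The block upper triangular matrices for the partition of the index set into `S` and its
complement. -/
def blockUpper (R : Type*) [CommRing R] (S : ι → Prop) : Set (Matrix ι ι R) :=
  {x | ∀ i j, ¬ S i → S j → x i j = 0}

variable {S : ι → Prop}

theorem toBlock_eq_zero_of_mem_blockUpper {x : Matrix ι ι R} (hx : x ∈ blockUpper R S) :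
    x.toBlock (fun i => ¬ S i) S = 0 := by
  ext i j; exact hx _ _ i.2 j.2

theorem one_mem_blockUpper [DecidableEq ι] : (1 : Matrix ι ι R) ∈ blockUpper R S := fun i j hi hj =>
  one_apply_ne (by rintro rfl; exact hi hj)

variable [Fintype ι]

theorem mul_mem_blockUpper {x y : Matrix ι ι R} (hx : x ∈ blockUpper R S)
    (hy : y ∈ blockUpper R S) : x * y ∈ blockUpper R S := by
  intro i j hi hj
  rw [mul_apply]
  refine Finset.sum_eq_zero fun m _ => ?_
  by_cases hm : S m
  · rw [hx i m hi hm, zero_mul]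
  · rw [hy m j hm hj, mul_zero]

theorem toBlock_mul_of_mem_blockUpper {x y : Matrix ι ι R}
    (hy : y ∈ blockUpper R S) : (x * y).toBlock S S = x.toBlock S S * y.toBlock S S := by
  rw [toBlock_mul_eq_add (p := S) (q := S) (r := S), toBlock_eq_zero_of_mem_blockUpper hy]
  simp

theorem toBlock_compl_mul_of_mem_blockUpper {x y : Matrix ι ι R} (hx : x ∈ blockUpper R S) :
    (x * y).toBlock (fun i => ¬ S i) (fun i => ¬ S i) =
      x.toBlock (fun i => ¬ S i) (fun i => ¬ S i) * y.toBlock (fun i => ¬ S i) (fun i => ¬ S i) := by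
  rw [toBlock_mul_eq_add (p := fun i => ¬ S i) (q := S) (r := fun i => ¬ S i),
    toBlock_eq_zero_of_mem_blockUpper hx]
  simp

variable [DecidableEq ι]

/-- Over a finite ring `g` has finite order, so its inverse is a power of `g`, and the set is closed
under products. -/
theorem inv_mem_blockUpper [Finite R] {g : GL ι R} (hg : g.val ∈ blockUpper R S) :
    g⁻¹.val ∈ blockUpper R S := by
  have : Finite (GL ι R) := inferInstance
  obtain ⟨m, hm, h⟩ := isOfFinOrder_iff_pow_eq_one.1 (isOfFinOrder_of_finite g)
  have hpow : ∀ k : ℕ, (g ^ k).val ∈ blockUpper R S := by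
    intro k
    induction k with
    | zero => simpa using one_mem_blockUpper
    | succ k ih => rw [pow_succ, Units.val_mul]; exact mul_mem_blockUpper ih hg
  have : g⁻¹ = g ^ (m - 1) := by
    rw [inv_eq_iff_mul_eq_one, ← pow_succ', Nat.sub_add_cancel hm, h]
  rw [this]; exact hpow _

theorem conj_mem_blockUpper_iff [Finite R] {g : GL ι R} (hg : g.val ∈ blockUpper R S)
    {x : Matrix ι ι R} : g.val * x * g⁻¹.val ∈ blockUpper R S ↔ x ∈ blockUpper R S := by
  refine ⟨fun h => ?_, fun h => mul_mem_blockUpper (mul_mem_blockUpper hg h)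
    (inv_mem_blockUpper hg)⟩
  have := mul_mem_blockUpper (mul_mem_blockUpper (inv_mem_blockUpper hg) h) hg
  simpa [mul_assoc] using this

end Matrix

namespace InvFun

open Matrix

variable {F : Type*} [Field F] {n : ℕ} {ι : Type*} [Fintype ι] [DecidableEq ι]
  {S : ι → Prop}

/-- Passing to a diagonal block is multiplicative on the parabolic, so conjugation by `g` becomes
conjugation by its diagonal block. -/
theorem ev_toBlock_conj [Finite F] (f : InvFun F n) {g : GL ι F} (hg : g.val ∈ blockUpper F S)
    {x : Matrix ι ι F} (hx : x ∈ blockUpper F S) :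
    ev f ((g.val * x * g⁻¹.val).toBlock S S) = ev f (x.toBlock S S) := by
  have hi := inv_mem_blockUpper hg
  rw [toBlock_mul_of_mem_blockUpper hi, toBlock_mul_of_mem_blockUpper hx, ev_conj]
  rw [← toBlock_mul_of_mem_blockUpper hi, ← Units.val_mul, mul_inv_cancel]
  exact toBlock_one_self _

theorem ev_toBlock_compl_conj (f : InvFun F n) {g : GL ι F} (hg : g.val ∈ blockUpper F S)
    {x : Matrix ι ι F} (hx : x ∈ blockUpper F S) :
    ev f ((g.val * x * g⁻¹.val).toBlock (fun i => ¬ S i) (fun i => ¬ S i)) =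
      ev f (x.toBlock (fun i => ¬ S i) (fun i => ¬ S i)) := by
  rw [toBlock_compl_mul_of_mem_blockUpper (mul_mem_blockUpper hg hx),
    toBlock_compl_mul_of_mem_blockUpper hg, ev_conj]
  rw [← toBlock_compl_mul_of_mem_blockUpper hg, ← Units.val_mul, mul_inv_cancel]
  exact toBlock_one_self _

end InvFun

/-! ### Bases adapted to two subspaces, and the Bruhat decomposition -/

section AdaptedBasis

variable {K V : Type*} [Field K] [AddCommGroup V] [Module K V]

/-- A basis `a` of the intersection extends to a basis `s` of `Y` and to a basis `t` of `W`. A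
vector in the spans of both `s` and `t \ a` lies in the span of `a`, hence vanishes, so the union is
independent and extends to a basis of the whole space. This is the linear algebra behind the Bruhat
decomposition. -/
theorem exists_adapted_basis (Y W : Submodule K V) :
    ∃ s t B : Set V, s ⊆ B ∧ t ⊆ B ∧ LinearIndepOn K id B ∧ Submodule.span K s = Y ∧
      Submodule.span K t = W ∧ Submodule.span K B = ⊤ := by
  obtain ⟨a, haYW, -, ha, hali⟩ := exists_linearIndepOn_id_extension
    (linearIndepOn_empty K id) (Set.empty_subset ((Y ⊓ W : Submodule K V) : Set V))
  obtain ⟨s, hsY, has, hs, hsli⟩ := exists_linearIndepOn_id_extension hali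
    (haYW.trans (SetLike.coe_subset_coe.2 inf_le_left))
  obtain ⟨t, htW, hat, ht, htli⟩ := exists_linearIndepOn_id_extension hali
    (haYW.trans (SetLike.coe_subset_coe.2 inf_le_right))
  have hu : LinearIndepOn K id (s ∪ (t \ a)) := by
    refine hsli.id_union (htli.mono Set.sdiff_subset) (Submodule.disjoint_def.2 fun v hv hv' => ?_)
    have hva : v ∈ Submodule.span K a := ha ⟨Submodule.span_le.2 hsY hv,
      Submodule.span_le.2 (Set.sdiff_subset.trans htW) hv'⟩
    rw [← Set.union_sdiff_cancel hat, linearIndepOn_id_union_iff Set.disjoint_sdiff_right] at htli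
    exact Submodule.disjoint_def.1 htli.2.2 v hva hv'
  obtain ⟨B, -, hB, hBs, hBli⟩ := exists_linearIndepOn_id_extension hu (Set.subset_univ _)
  refine ⟨s, t, B, Set.subset_union_left.trans hB, fun v hv => ?_, hBli,
    le_antisymm (Submodule.span_le.2 hsY) hs, le_antisymm (Submodule.span_le.2 htW) ht,
    top_le_iff.1 fun v _ => hBs (Set.mem_univ v)⟩
  by_cases hva : v ∈ a
  · exact hB (Or.inl (has hva))
  · exact hB (Or.inr ⟨hv, hva⟩)

end AdaptedBasis

namespace Matrix

variable {F : Type*} [Field F] {ι : Type*}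

/-- The vectors supported on `S`. -/
def coordSubspace (F : Type*) [Field F] (S : ι → Prop) : Submodule F (ι → F) where
  carrier := {v | ∀ i, ¬ S i → v i = 0}
  add_mem' := fun hv hw i hi => by simp [hv i hi, hw i hi]
  zero_mem' := fun _ _ => rfl
  smul_mem' := fun c v hv i hi => by simp [hv i hi]

/-- Vectors supported on `S` are functions on `S`. -/
noncomputable def coordSubspaceEquiv (F : Type*) [Field F] (S : ι → Prop) :
    coordSubspace F S ≃ₗ[F] ({i // S i} → F) where
  toFun v i := v.1 i
  map_add' _ _ := rfl
  map_smul' _ _ := rfl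
  invFun w := ⟨fun i => if h : S i then w ⟨i, h⟩ else 0, fun i hi => dif_neg hi⟩
  left_inv v := by
    ext i
    by_cases h : S i
    · simp [h]
    · simp [h, v.2 i h]
  right_inv w := by ext i; simp [i.2]

theorem mem_blockUpper_of_cols {S : ι → Prop} {x : Matrix ι ι F}
    (h : ∀ j, S j → x.col j ∈ coordSubspace F S) : x ∈ blockUpper F S :=
  fun i j hi hj => h j hj i hi

variable [Fintype ι]

theorem finrank_coordSubspace (S : ι → Prop) :
    Module.finrank F (coordSubspace F S) = Fintype.card {i // S i} := by
  rw [(coordSubspaceEquiv F S).finrank_eq, Module.finrank_fintype_fun_eq_card]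

theorem mulVec_mem_coordSubspace {S : ι → Prop} {x : Matrix ι ι F} (hx : x ∈ blockUpper F S)
    {v : ι → F} (hv : v ∈ coordSubspace F S) : x *ᵥ v ∈ coordSubspace F S := by
  intro i hi
  rw [mulVec, dotProduct]
  refine Finset.sum_eq_zero fun j _ => ?_
  by_cases hj : S j
  · rw [hx i j hi hj, zero_mul]
  · rw [hv j hj, mul_zero]

theorem exists_equiv_of_subset {V : Type*} [AddCommGroup V] [Module F V] [FiniteDimensional F V]
    {s B : Set V} (hsB : s ⊆ B) (hB : LinearIndepOn F id B) (hspan : Submodule.span F B = ⊤)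
    (hV : Module.finrank F V = Fintype.card ι) (S : ι → Prop)
    (hs : Module.finrank F (Submodule.span F s) = Fintype.card {i // S i}) :
    ∃ ε : ι ≃ B, ∀ i, S i ↔ (ε i : V) ∈ s := by
  have : Finite B := LinearIndependent.finite hB
  have : Fintype B := Fintype.ofFinite B
  let bas : Module.Basis B F V := Module.Basis.mk hB.linearIndependent (by simpa using hspan.ge)
  have hcard : Fintype.card ι = Fintype.card B := by
    rw [← hV, Module.finrank_eq_card_basis bas]
  let ε₀ : ι ≃ B := Fintype.equivOfCardEq hcard
  have hs' : Fintype.card {i // S i} = Fintype.card {i // (ε₀ i : V) ∈ s} := by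
    have e : {i // (ε₀ i : V) ∈ s} ≃ s :=
      { toFun := fun i => ⟨ε₀ i.1, i.2⟩
        invFun := fun v => ⟨ε₀.symm ⟨v.1, hsB v.2⟩, by simp⟩
        left_inv := fun i => by simp
        right_inv := fun v => by simp }
    have : Fintype s := Fintype.ofEquiv _ e
    rw [← hs, Fintype.card_congr e]
    have := finrank_span_set_eq_card (R := F) (s := s) (hB.mono hsB).linearIndependent
    rw [this, Set.toFinset_card]
  -- An arbitrary enumeration is corrected by a permutation carrying `S` onto the indices of the
  -- vectors in `s`.
  let σ := (Fintype.equivOfCardEq hs').extendSubtype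
  refine ⟨σ.trans ε₀, fun i => ⟨fun hi => ?_, fun hi => ?_⟩⟩
  · exact (Fintype.equivOfCardEq hs').extendSubtype_mem i hi
  · by_contra h
    exact (Fintype.equivOfCardEq hs').extendSubtype_not_mem i h hi

variable [DecidableEq ι]

theorem exists_gl_of_basis {B : Set (ι → F)} (hB : LinearIndepOn F id B) (ε : ι ≃ B) :
    ∃ b : GL ι F, b.val = of fun i j => (ε j : ι → F) i := by
  change IsUnit _
  rw [← linearIndependent_cols_iff_isUnit]
  exact hB.linearIndependent.comp ε ε.injective

/-- Every invertible matrix is a product of matrices in the parabolic subgroups attached to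
`S'` and `S` and of a permutation matrix. -/
theorem exists_bruhat_decomposition [Finite F] (S S' : ι → Prop) (γ : GL ι F) :
    ∃ (b q : GL ι F) (τ : Equiv.Perm ι), b.val ∈ blockUpper F S ∧ q.val ∈ blockUpper F S' ∧
      ∀ x, γ.val * x * γ⁻¹.val = q.val * (b.val * x * b⁻¹.val).submatrix τ τ * q⁻¹.val := by
  have hγ1 : γ.val * γ⁻¹.val = 1 := by rw [← Units.val_mul, mul_inv_cancel, Units.val_one]
  have hγ2 : γ⁻¹.val * γ.val = 1 := by rw [← Units.val_mul, inv_mul_cancel, Units.val_one]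
  let Γ : (ι → F) ≃ₗ[F] (ι → F) := LinearEquiv.ofLinearMap γ.val.mulVecLin γ⁻¹.val.mulVecLin
    (by rw [← mulVecLin_mul, hγ1, mulVecLin_one]) (by rw [← mulVecLin_mul, hγ2, mulVecLin_one])
  -- One basis is chosen adapted both to the subspace fixed by the first parabolic and to the
  -- preimage under `γ` of the one fixed by the second. Enumerating it compatibly with `S` gives
  -- `b₀`, compatibly with `S'` gives `b₁`. They differ by a permutation of columns, and `γ = (γ b₁)
  -- b₁⁻¹` is the required factorisation.
  obtain ⟨s, t, B, hsB, htB, hB, hs, ht, hspan⟩ :=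
    exists_adapted_basis (coordSubspace F S) ((coordSubspace F S').comap Γ.toLinearMap)
  have hV : Module.finrank F (ι → F) = Fintype.card ι := Module.finrank_fintype_fun_eq_card F
  obtain ⟨ε, hε⟩ := exists_equiv_of_subset hsB hB hspan hV S (by rw [hs, finrank_coordSubspace])
  obtain ⟨ε', hε'⟩ := exists_equiv_of_subset htB hB hspan hV S' (by
    rw [ht, ← finrank_coordSubspace (F := F)]
    exact (Γ.submoduleMap _).finrank_eq.trans
      (by rw [Submodule.map_comap_eq_of_surjective Γ.surjective]))
  obtain ⟨b₀, hb₀⟩ := exists_gl_of_basis hB ε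
  obtain ⟨b₁, hb₁⟩ := exists_gl_of_basis hB ε'
  have hb : b₁.val = b₀.val.submatrix (Equiv.refl ι) (ε'.trans ε.symm) := by
    rw [hb₀, hb₁]; ext i j; simp
  have hbi : b₁⁻¹.val = b₀⁻¹.val.submatrix (ε'.trans ε.symm) (Equiv.refl ι) := by
    rw [coe_units_inv, hb, inv_submatrix_equiv, coe_units_inv]
  refine ⟨b₀⁻¹, γ * b₁, ε'.trans ε.symm, inv_mem_blockUpper (mem_blockUpper_of_cols fun j hj => ?_),
    mem_blockUpper_of_cols fun j hj => ?_, fun x => ?_⟩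
  · rw [hb₀, ← hs]
    exact Submodule.subset_span ((hε j).1 hj)
  · have h1 : (ε' j : ι → F) ∈ (coordSubspace F S').comap Γ.toLinearMap := by
      rw [← ht]; exact Submodule.subset_span ((hε' j).1 hj)
    have h2 : (γ * b₁).val.col j = Γ (ε' j : ι → F) := by
      ext i; rw [Units.val_mul, hb₁]; rfl
    rw [h2]; exact h1
  · have h1 : (b₀⁻¹.val * x * b₀⁻¹⁻¹.val).submatrix (ε'.trans ε.symm) (ε'.trans ε.symm) =
        b₁⁻¹.val * x * b₁.val := by
      rw [hb, hbi, inv_inv, ← submatrix_mul_equiv (b₀⁻¹.val * x) b₀.val _ (Equiv.refl ι),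
        ← submatrix_mul_equiv b₀⁻¹.val x _ (Equiv.refl ι)]
      rfl
    have h3 : b₁.val * b₁⁻¹.val = 1 := by rw [← Units.val_mul, mul_inv_cancel, Units.val_one]
    rw [h1, _root_.mul_inv_rev, Units.val_mul, Units.val_mul]
    calc γ.val * x * γ⁻¹.val = γ.val * (b₁.val * b₁⁻¹.val) * x * (b₁.val * b₁⁻¹.val) * γ⁻¹.val := by
          rw [h3, mul_one, mul_one]
      _ = _ := by simp only [mul_assoc]

/-- A subspace of the same dimension as a coordinate subspace is a translate of it. -/
theorem exists_gl_map_coordSubspace (S : ι → Prop) (Y : Submodule F (ι → F))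
    (hY : Module.finrank F Y = Fintype.card {i // S i}) :
    ∃ b : GL ι F, ∀ v, b.val *ᵥ v ∈ Y ↔ v ∈ coordSubspace F S := by
  obtain ⟨s, t, B, hsB, htB, hB, hs, ht, hspan⟩ := exists_adapted_basis Y Y
  have hV : Module.finrank F (ι → F) = Fintype.card ι := Module.finrank_fintype_fun_eq_card F
  obtain ⟨ε, hε⟩ := exists_equiv_of_subset hsB hB hspan hV S (by rw [hs, hY])
  obtain ⟨b, hb⟩ := exists_gl_of_basis hB ε
  have hle : (coordSubspace F S).map b.val.mulVecLin ≤ Y := by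
    rintro _ ⟨v, hv, rfl⟩
    simp only [mulVecLin_apply, mulVec_eq_sum, op_smul_eq_smul]
    refine Submodule.sum_mem Y fun j _ => ?_
    by_cases hj : S j
    · refine Submodule.smul_mem _ _ ?_
      rw [hb, ← hs]
      exact Submodule.subset_span ((hε j).1 hj)
    · rw [hv j hj]; simp
  have hinj : Function.Injective b.val.mulVecLin := mulVec_injective_of_isUnit b.isUnit
  have heq : (coordSubspace F S).map b.val.mulVecLin = Y := by
    refine Submodule.eq_of_le_of_finrank_eq hle ?_
    rw [hY, ← finrank_coordSubspace (F := F)]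
    exact (Submodule.equivMapOfInjective _ hinj _).finrank_eq.symm
  refine ⟨b, fun v => ⟨fun h => ?_, fun h => hle ⟨v, h, rfl⟩⟩⟩
  rw [← heq] at h
  obtain ⟨w, hw, hwv⟩ := h
  rwa [← hinj hwv]

end Matrix

/-! ### Induction as a product, and Frobenius reciprocity -/

namespace Matrix

theorem sum_ite_mem_blockUpper {F : Type*} [Field F] [Fintype F] {ι α β : Type*} [Fintype ι]
    [DecidableEq ι] [Fintype α] [DecidableEq α] [Fintype β] [DecidableEq β] {M : Type*}
    [AddCommMonoid M] {S : ι → Prop} (e : α ⊕ β ≃ ι) (hl : ∀ a, S (e (Sum.inl a)))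
    (hr : ∀ b, ¬ S (e (Sum.inr b))) (G : Matrix ι ι F → M) :
    ∑ x : Matrix ι ι F, (if x ∈ blockUpper F S then G x else 0) =
      ∑ a : Matrix α α F, ∑ u : Matrix α β F, ∑ d : Matrix β β F,
        G ((fromBlocks a u 0 d).submatrix e.symm e.symm) := by
  rw [← Finset.sum_filter]
  simp only [← Fintype.sum_prod_type']
  symm
  refine Finset.sum_nbij'
    (fun p => (fromBlocks p.1 p.2.1 0 p.2.2).submatrix e.symm e.symm)
    (fun x => ((x.submatrix e e).toBlocks₁₁, (x.submatrix e e).toBlocks₁₂,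
      (x.submatrix e e).toBlocks₂₂)) ?_ ?_ ?_ ?_ ?_
  · rintro ⟨a, u, d⟩ -
    rw [Finset.mem_filter]
    refine ⟨Finset.mem_univ _, fun i j hi hj => ?_⟩
    obtain ⟨i, rfl⟩ := e.surjective i
    obtain ⟨j, rfl⟩ := e.surjective j
    rcases i with i | i
    · exact absurd (hl i) hi
    rcases j with j | j
    · simp
    · exact absurd hj (hr j)
  · intro x _; exact Finset.mem_univ _
  · rintro ⟨a, u, d⟩ -
    simp
  · intro x hx
    rw [Finset.mem_filter] at hx
    have h0 : (x.submatrix e e).toBlocks₂₁ = 0 := by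
      ext i j; exact hx.2 _ _ (hr i) (hl j)
    have := fromBlocks_toBlocks (x.submatrix e e)
    rw [h0] at this
    simp only [this]
    simp
  · intro _ _; rfl

end Matrix

/-- Harish-Chandra induction as a bilinear product, with a flexible degree. -/
noncomputable def hcProd {F : Type*} [Field F] [Fintype F] {k l n : ℕ} (h : k + l = n) :
    InvFun F k →ₗ[ℂ] InvFun F l →ₗ[ℂ] InvFun F n :=
  LinearMap.mk₂ ℂ (fun f g => h ▸ hcInd (boxProd f g))
    (fun f f' g => by
      subst h; ext x
      simp [hcInd, boxProd, add_mul, mul_add, Finset.sum_add_distrib])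
    (fun c f g => by
      subst h; ext x
      simp only [hcInd, boxProd, SetLike.val_smul, Pi.smul_apply, smul_eq_mul, mul_assoc,
        ← Finset.mul_sum]
      ring)
    (fun f g g' => by
      subst h; ext x
      simp [hcInd, boxProd, mul_add, Finset.sum_add_distrib])
    (fun c f g => by
      subst h; ext x
      simp only [hcInd, boxProd, SetLike.val_smul, Pi.smul_apply, smul_eq_mul,
        mul_left_comm _ c, ← Finset.mul_sum])

theorem hcProd_rfl {F : Type*} [Field F] [Fintype F] {k l : ℕ} (f : InvFun F k) (g : InvFun F l) :
    hcProd rfl f g = hcInd (boxProd f g) := rfl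

/-- The first `k` indices. -/
def firstIndices (n k : ℕ) (i : Fin n) : Prop := i.1 < k

theorem stdParabolic_eq_blockUpper (F : Type*) [Field F] (k l : ℕ) :
    stdParabolic F k l = Matrix.blockUpper F (firstIndices (k + l) k) := by
  ext x
  constructor
  · intro hx i j hi hj
    have hi' : k ≤ i.1 := not_lt.1 hi
    have := hx ⟨i.1 - k, by omega⟩ ⟨j.1, hj⟩
    convert this
    · ext; simp; omega
    · rfl
  · intro hx i j
    refine hx _ _ ?_ ?_
    · simp [firstIndices]
    · simp [firstIndices]

/-- The first `k` indices in `Fin n`, where `n = k + l`. -/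
def firstIndicesEquiv {k l n : ℕ} (h : k + l = n) : {i : Fin n // firstIndices n k i} ≃ Fin k where
  toFun i := ⟨i.1.1, i.2⟩
  invFun j := ⟨⟨j.1, by omega⟩, j.2⟩
  left_inv _ := rfl
  right_inv _ := rfl

/-- The last `l` indices in `Fin n`, where `n = k + l`. -/
def lastIndicesEquiv {k l n : ℕ} (h : k + l = n) :
    {i : Fin n // ¬ firstIndices n k i} ≃ Fin l where
  toFun i := ⟨i.1.1 - k, by have : ¬ i.1.1 < k := i.2; omega⟩
  invFun j := ⟨⟨k + j.1, by omega⟩, by simp [firstIndices]⟩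
  left_inv i := by
    have : ¬ i.1.1 < k := i.2
    ext; simp; omega
  right_inv j := by ext; simp

namespace InvFun

open Matrix

variable {F : Type*} [Field F] [Fintype F] {k l n : ℕ}

theorem exists_hcProd_apply (F : Type*) [Field F] [Fintype F] {k l n : ℕ} (h : k + l = n) :
    ∃ c : ℂ, c ≠ 0 ∧ ∀ (f : InvFun F k) (g : InvFun F l) (x : Matrix (Fin n) (Fin n) F),
      (hcProd h f g).1 x = c * ∑ γ : GL (Fin n) F,
        if γ.val * x * γ⁻¹.val ∈ blockUpper F (firstIndices n k) then
          ev f ((γ.val * x * γ⁻¹.val).toBlock (firstIndices n k) (firstIndices n k)) *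
          ev g ((γ.val * x * γ⁻¹.val).toBlock (fun i => ¬ firstIndices n k i)
            (fun i => ¬ firstIndices n k i)) else 0 := by
  subst h
  refine ⟨(Nat.card {g : GL (Fin (k + l)) F // g.val ∈ stdParabolic F k l} : ℂ)⁻¹, ?_,
    fun f g x => ?_⟩
  · have : Nonempty {g : GL (Fin (k + l)) F // g.val ∈ stdParabolic F k l} := by
      refine ⟨1, ?_⟩
      rw [stdParabolic_eq_blockUpper]
      exact one_mem_blockUpper
    exact inv_ne_zero (Nat.cast_ne_zero.2 Nat.card_pos.ne')
  · rw [hcProd_rfl]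
    simp only [hcInd, boxProd, Finset.sum_filter, stdParabolic_eq_blockUpper, stdLeviProj]
    refine congrArg _ (Finset.sum_congr rfl fun γ _ => ?_)
    refine if_congr Iff.rfl ?_ rfl
    rw [ev_eq f (firstIndicesEquiv rfl), ev_eq g (lastIndicesEquiv rfl)]
    rfl

/-- Substituting the conjugate of `x` by `γ` and using the invariance of `φ`, every `γ` contributes
the same sum over the parabolic subalgebra. -/
theorem exists_pairing_hcProd (F : Type*) [Field F] [Fintype F] {k l n : ℕ} (h : k + l = n) :
    ∃ c : ℂ, c ≠ 0 ∧ ∀ (f : InvFun F k) (g : InvFun F l) (φ : InvFun F n),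
      pairing F n (hcProd h f g) φ = c * ∑ x, if x ∈ blockUpper F (firstIndices n k) then
        ev f (x.toBlock (firstIndices n k) (firstIndices n k)) *
        ev g (x.toBlock (fun i => ¬ firstIndices n k i) (fun i => ¬ firstIndices n k i)) * φ.1 x
        else 0 := by
  obtain ⟨c, hc, H⟩ := exists_hcProd_apply F h
  refine ⟨c * Fintype.card (GL (Fin n) F), mul_ne_zero hc (Nat.cast_ne_zero.2
    Fintype.card_ne_zero), fun f g φ => ?_⟩
  simp only [pairing_apply, H, mul_assoc c, ← Finset.mul_sum, Finset.sum_mul]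
  rw [Finset.sum_comm]
  congr 1
  rw [← nsmul_eq_mul, ← Finset.card_univ, ← Finset.sum_const]
  refine Finset.sum_congr rfl fun γ _ => ?_
  let E : Matrix (Fin n) (Fin n) F ≃ Matrix (Fin n) (Fin n) F :=
    { toFun := fun x => γ.val * x * γ⁻¹.val
      invFun := fun x => γ⁻¹.val * x * γ.val
      left_inv := fun x => by simp [mul_assoc]
      right_inv := fun x => by simp [mul_assoc] }
  refine Fintype.sum_equiv E _ _ fun x => ?_
  change _ = if γ.val * x * γ⁻¹.val ∈ _ then _ * φ.1 (γ.val * x * γ⁻¹.val) else 0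
  rw [φ.2 γ x, ite_mul, zero_mul]
  rfl

theorem exists_pairing_hcProd_fromBlocks (F : Type*) [Field F] [Fintype F] {k l n : ℕ}
    (h : k + l = n) :
    ∃ c : ℂ, c ≠ 0 ∧ ∀ (f : InvFun F k) (g : InvFun F l) (φ : InvFun F n),
      pairing F n (hcProd h f g) φ = c * ∑ a : Matrix (Fin k) (Fin k) F,
        ∑ u : Matrix (Fin k) (Fin l) F, ∑ d : Matrix (Fin l) (Fin l) F,
          f.1 a * g.1 d * ev φ (fromBlocks a u 0 d) := by
  obtain ⟨c, hc, H⟩ := exists_pairing_hcProd F h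
  refine ⟨c, hc, fun f g φ => ?_⟩
  let e : Fin k ⊕ Fin l ≃ Fin n := finSumFinEquiv.trans (finCongr h)
  rw [H, sum_ite_mem_blockUpper (S := firstIndices n k) e
    (fun a => by simp [e, firstIndices]) (fun b => by simp [e, firstIndices])]
  refine congrArg _ (Finset.sum_congr rfl fun a _ => Finset.sum_congr rfl fun u _ =>
    Finset.sum_congr rfl fun d _ => ?_)
  rw [ev_eq f (firstIndicesEquiv h), ev_eq g (lastIndicesEquiv h), ev_eq φ e]
  refine congrArg₂ (· * ·) (congrArg₂ (· * ·) (congrArg f.1 ?_) (congrArg g.1 ?_)) rfl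
  · ext i j
    have hi : ∀ i : Fin k, e.symm ((firstIndicesEquiv h).symm i).1 = Sum.inl i := by
      intro i; rw [Equiv.symm_apply_eq]; ext; simp [e, firstIndicesEquiv]
    simp only [submatrix_apply, toBlock_apply, hi, fromBlocks_apply₁₁]
  · ext i j
    have hi : ∀ i : Fin l, e.symm ((lastIndicesEquiv h).symm i).1 = Sum.inr i := by
      intro i; rw [Equiv.symm_apply_eq]; ext; simp [e, lastIndicesEquiv]
    simp only [submatrix_apply, toBlock_apply, hi, fromBlocks_apply₂₂]

/-- The indicator function of an orbit under conjugation. -/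
noncomputable def orbitIndicator (x : Matrix (Fin n) (Fin n) F) : InvFun F n :=
  ⟨fun y => if ∃ g : GL (Fin n) F, y = g.val * x * g⁻¹.val then 1 else 0, fun h y => by
    refine if_congr ⟨?_, ?_⟩ rfl rfl
    · rintro ⟨g, hg⟩
      refine ⟨h⁻¹ * g, ?_⟩
      rw [_root_.mul_inv_rev, inv_inv, Units.val_mul, Units.val_mul]
      have : h⁻¹.val * (h.val * y * h⁻¹.val) * h.val = y := by simp [mul_assoc]
      rw [← this, hg]; simp only [mul_assoc]
    · rintro ⟨g, rfl⟩
      refine ⟨h * g, ?_⟩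
      rw [_root_.mul_inv_rev, Units.val_mul, Units.val_mul]; simp only [mul_assoc]⟩

/-- Conjugation by diag(g, h) permutes the upper right blocks by `u ↦ g u h⁻¹`. -/
theorem sum_ev_fromBlocks_conj (φ : InvFun F n) {α β : Type*} [Fintype α] [DecidableEq α]
    [Fintype β] [DecidableEq β] (g : GL α F) (h : GL β F) (a : Matrix α α F) (d : Matrix β β F) :
    ∑ u : Matrix α β F, ev φ (fromBlocks (g.val * a * g⁻¹.val) u 0 (h.val * d * h⁻¹.val)) =
      ∑ u : Matrix α β F, ev φ (fromBlocks a u 0 d) := by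
  let E : Matrix α β F ≃ Matrix α β F :=
    { toFun := fun x => g.val * x * h⁻¹.val
      invFun := fun x => g⁻¹.val * x * h.val
      left_inv := fun x => by
        have h1 : g⁻¹.val * g.val = 1 := by rw [← Units.val_mul, inv_mul_cancel, Units.val_one]
        have h2 : h⁻¹.val * h.val = 1 := by rw [← Units.val_mul, inv_mul_cancel, Units.val_one]
        calc _ = (g⁻¹.val * g.val) * x * (h⁻¹.val * h.val) := by simp only [Matrix.mul_assoc]
          _ = x := by rw [h1, h2, Matrix.one_mul, Matrix.mul_one]
      right_inv := fun x => by
        have h1 : g.val * g⁻¹.val = 1 := by rw [← Units.val_mul, mul_inv_cancel, Units.val_one]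
        have h2 : h.val * h⁻¹.val = 1 := by rw [← Units.val_mul, mul_inv_cancel, Units.val_one]
        calc _ = (g.val * g⁻¹.val) * x * (h.val * h⁻¹.val) := by simp only [Matrix.mul_assoc]
          _ = x := by rw [h1, h2, Matrix.one_mul, Matrix.mul_one] }
  refine (Fintype.sum_equiv E _ _ fun u => ?_).symm
  have h1 : g.val * g⁻¹.val = 1 := by rw [← Units.val_mul, mul_inv_cancel, Units.val_one]
  have h2 : h.val * h⁻¹.val = 1 := by rw [← Units.val_mul, mul_inv_cancel, Units.val_one]
  rw [← ev_conj φ (fromBlocks g.val 0 0 h.val) (fromBlocks g⁻¹.val 0 0 h⁻¹.val)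
    (by simp [fromBlocks_multiply, h1, h2, -coe_units_inv])]
  simp [fromBlocks_multiply, E]

/-- Frobenius reciprocity: a function is orthogonal to all products if and only if its sums over
the cosets of the nilradicals of the standard parabolic subalgebras vanish. -/
theorem pairing_hcProd_eq_zero_iff (h : k + l = n) (φ : InvFun F n) :
    (∀ (f : InvFun F k) (g : InvFun F l), pairing F n (hcProd h f g) φ = 0) ↔
      ∀ (a : Matrix (Fin k) (Fin k) F) (d : Matrix (Fin l) (Fin l) F),
        ∑ u : Matrix (Fin k) (Fin l) F, ev φ (fromBlocks a u 0 d) = 0 := by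
  obtain ⟨c, hc, H⟩ := exists_pairing_hcProd_fromBlocks F h
  have H' : ∀ (f : InvFun F k) (g : InvFun F l), pairing F n (hcProd h f g) φ =
      c * ∑ a : Matrix (Fin k) (Fin k) F, ∑ d : Matrix (Fin l) (Fin l) F,
        f.1 a * g.1 d * ∑ u : Matrix (Fin k) (Fin l) F, ev φ (fromBlocks a u 0 d) := by
    intro f g
    rw [H]
    refine congrArg _ (Finset.sum_congr rfl fun a _ => ?_)
    rw [Finset.sum_comm]
    simp only [Finset.mul_sum]
  constructor
  · intro h0 a d
    -- The coset sum is constant on the product of the two orbits, so testing on orbit indicators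
    -- returns it times the nonzero orbit sizes.
    have h1 := h0 (orbitIndicator a) (orbitIndicator d)
    rw [H', mul_eq_zero, or_iff_right hc] at h1
    set s := ∑ u : Matrix (Fin k) (Fin l) F, ev φ (fromBlocks a u 0 d) with hs
    have h2 : ∀ a' d', (orbitIndicator a).1 a' * (orbitIndicator d).1 d' *
        ∑ u : Matrix (Fin k) (Fin l) F, ev φ (fromBlocks a' u 0 d') =
        (orbitIndicator a).1 a' * (orbitIndicator d).1 d' * s := by
      intro a' d'
      simp only [orbitIndicator]
      split_ifs with h3 h4
      · obtain ⟨g, rfl⟩ := h3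
        obtain ⟨g', rfl⟩ := h4
        rw [sum_ev_fromBlocks_conj]
      all_goals simp
    simp only [h2, ← Finset.sum_mul, ← Finset.mul_sum] at h1
    have hne : ∀ {m : ℕ} (x : Matrix (Fin m) (Fin m) F), ∑ y, (orbitIndicator x).1 y ≠ 0 := by
      intro m x
      simp only [orbitIndicator, Finset.sum_boole]
      rw [Nat.cast_ne_zero, ← Nat.pos_iff_ne_zero, Finset.card_pos]
      exact ⟨x, by rw [Finset.mem_filter]; exact ⟨Finset.mem_univ _, 1, by simp⟩⟩
    exact (mul_eq_zero.1 h1).resolve_left (mul_ne_zero (hne a) (hne d))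
  · intro h0 f g
    rw [H']
    simp [h0]

end InvFun

/-! ### Pre-cuspidality as orthogonality to products -/

/-- The decomposition of `Fⁿ` into the vectors supported on `T` and those supported on the
complement of `T`. -/
noncomputable def LeviDecomposition.ofSubset (F : Type*) [Field F] {n : ℕ} (T : Fin n → Prop)
    (h₁ : ∃ i, T i) (h₂ : ∃ i, ¬ T i) : LeviDecomposition F n 2 where
  W := ![Matrix.coordSubspace F T, Matrix.coordSubspace F fun i => ¬ T i]
  ne_bot := by
    have key : ∀ T : Fin n → Prop, (∃ i, T i) → Matrix.coordSubspace F T ≠ ⊥ := by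
      rintro T ⟨i, hi⟩ h
      have hm : (Pi.single i 1 : Fin n → F) ∈ Matrix.coordSubspace F T := fun j hj =>
        Pi.single_eq_of_ne (by rintro rfl; exact hj hi) _
      rw [h, Submodule.mem_bot] at hm
      simpa using congrFun hm i
    rw [Fin.forall_fin_two]
    exact ⟨key T h₁, key _ h₂⟩
  isInternal := by
    rw [DirectSum.isInternal_submodule_iff_isCompl _ (i := 0) (j := 1) (by decide)
      (by ext i; fin_cases i <;> simp)]
    refine ⟨Submodule.disjoint_def.2 fun v hv hv' => ?_, ?_⟩
    · ext i
      by_cases hi : T i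
      · exact hv' i (not_not.2 hi)
      · exact hv i hi
    · rw [codisjoint_iff, Submodule.eq_top_iff']
      intro v
      rw [Submodule.mem_sup]
      refine ⟨fun i => if T i then v i else 0, fun i hi => if_neg hi,
        fun i => if T i then 0 else v i, fun i hi => if_pos (not_not.1 hi), ?_⟩
      ext i
      by_cases hi : T i <;> simp [hi]

theorem Matrix.mulVec_apply_eq_zero {R ι κ : Type*} [NonUnitalNonAssocSemiring R] [Fintype κ]
    {x : Matrix ι κ R} {v : κ → R} {i : ι} (h : ∀ j, x i j * v j = 0) : x.mulVec v i = 0 :=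
  Finset.sum_eq_zero fun j _ => h j

namespace InvFun

open Matrix

variable {F : Type*} [Field F] {n : ℕ}

theorem mem_nilradical_ofSubset {T : Fin n → Prop} (h₁ : ∃ i, T i) (h₂ : ∃ i, ¬ T i)
    {y : Matrix (Fin n) (Fin n) F} :
    y ∈ (LeviDecomposition.ofSubset F T h₁ h₂).nilradical ↔
      ∀ i j, ¬ (T i ∧ ¬ T j) → y i j = 0 := by
  have hcol : ∀ i j, y i j = (y *ᵥ Pi.single j 1) i := by
    intro i j; simp
  set D := LeviDecomposition.ofSubset F T h₁ h₂ with hD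
  have hW0 : ⨆ j ≤ (0 : Fin 2), D.W j = coordSubspace F T :=
    le_antisymm (iSup₂_le fun j hj => by
      have : j = 0 := le_antisymm hj (Fin.zero_le _)
      subst this; exact le_rfl) (le_iSup₂_of_le (0 : Fin 2) le_rfl le_rfl)
  have hW0' : ⨆ j < (0 : Fin 2), D.W j = ⊥ :=
    le_bot_iff.1 (iSup₂_le fun j hj => absurd hj (Fin.not_lt_zero j))
  have hW1 : ⨆ j < (1 : Fin 2), D.W j = coordSubspace F T :=
    le_antisymm (iSup₂_le fun j hj => by
      have : j = 0 := by fin_cases j <;> simp at hj ⊢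
      subst this; exact le_rfl) (le_iSup₂_of_le (0 : Fin 2) (by decide) le_rfl)
  have hW1' : ⨆ j ≤ (1 : Fin 2), D.W j = ⊤ := by
    rw [← D.isInternal.submodule_iSup_eq_top]
    exact le_antisymm (iSup₂_le fun j _ => le_iSup D.W j)
      (iSup_le fun j => le_iSup₂_of_le j (Fin.le_last j) le_rfl)
  constructor
  · intro hy i j hij
    rw [hcol]
    by_cases hj : T j
    · have := hy 0 (Pi.single j 1) (by
        rw [hW0]
        exact fun m hm => Pi.single_eq_of_ne (by rintro rfl; exact hm hj) _)
      rw [hW0', Submodule.mem_bot] at this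
      rw [this]; rfl
    · have := hy 1 (Pi.single j 1) (by rw [hW1']; trivial)
      rw [hW1] at this
      exact this i fun hi => hij ⟨hi, hj⟩
  · intro hy
    refine Fin.forall_fin_two.2 ⟨fun v hv => ?_, fun v _ => ?_⟩
    · rw [hW0] at hv
      rw [hW0', Submodule.mem_bot]
      ext i
      refine mulVec_apply_eq_zero fun j => ?_
      by_cases hj : T j
      · rw [hy i j (by tauto), zero_mul]
      · rw [hv j hj, mul_zero]
    · rw [hW1]
      exact fun i hi => mulVec_apply_eq_zero fun j => by rw [hy i j (by tauto), zero_mul]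

variable [Fintype F] {k l : ℕ}

theorem card_unipotentRadical_ne_zero {r : ℕ} (D : LeviDecomposition F n r) :
    (Nat.card D.unipotentRadical : ℂ)⁻¹ ≠ 0 := by
  have : Nonempty D.unipotentRadical := by
    refine ⟨1, fun i v _ => ?_⟩
    simp
  exact inv_ne_zero (Nat.cast_ne_zero.2 Nat.card_pos.ne')

theorem sum_nilradical_eq_zero {r : ℕ} {D : LeviDecomposition F n r} {f : InvFun F n}
    (h : D.hcRes f = 0) {x : Matrix (Fin n) (Fin n) F} (hx : x ∈ D.levi) :
    ∑ y, (if y ∈ D.nilradical then f.1 (x + y) else 0) = 0 := by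
  have := congrFun h ⟨x, hx⟩
  rw [← Finset.sum_filter]
  exact (mul_eq_zero.1 this).resolve_left (card_unipotentRadical_ne_zero D)

/-- A pre-cuspidal function has vanishing sums over the cosets of the nilradical of any
two-block parabolic subalgebra. -/
theorem sum_ev_fromBlocks_eq_zero {f : InvFun F n} (hf : IsPreCuspidal f) {α β : Type*}
    [Fintype α] [DecidableEq α] [Fintype β] [DecidableEq β] [Nonempty α] [Nonempty β]
    (e : α ⊕ β ≃ Fin n) (a : Matrix α α F) (d : Matrix β β F) :
    ∑ u : Matrix α β F, ev f (fromBlocks a u 0 d) = 0 := by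
  let T : Fin n → Prop := fun i => (e.symm i).isLeft = true
  have h₁ : ∃ i, T i := ⟨e (Sum.inl (Classical.arbitrary α)), by simp [T]⟩
  have h₂ : ∃ i, ¬ T i := ⟨e (Sum.inr (Classical.arbitrary β)), by simp [T]⟩
  have hx : (fromBlocks a 0 0 d).submatrix e.symm e.symm ∈
      (LeviDecomposition.ofSubset F T h₁ h₂).levi := by
    refine Fin.forall_fin_two.2 ⟨?_, ?_⟩
    · refine fun v hv => mulVec_mem_coordSubspace (S := T) (fun i j hi hj => ?_) hv
      obtain ⟨i, rfl⟩ := e.surjective i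
      obtain ⟨j, rfl⟩ := e.surjective j
      rcases i with i | i <;> rcases j with j | j <;> simp [T] at hi hj ⊢
    · refine fun v hv => mulVec_mem_coordSubspace (S := fun i => ¬ T i) (fun i j hi hj => ?_) hv
      obtain ⟨i, rfl⟩ := e.surjective i
      obtain ⟨j, rfl⟩ := e.surjective j
      rcases i with i | i <;> rcases j with j | j <;> simp [T] at hi hj ⊢
  have h0 := sum_nilradical_eq_zero (hf 2 le_rfl (LeviDecomposition.ofSubset F T h₁ h₂)) hx
  rw [← h0, ← Finset.sum_filter]
  refine Finset.sum_nbij' (fun u => (fromBlocks 0 u 0 0).submatrix e.symm e.symm)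
    (fun x => (x.submatrix e e).toBlocks₁₂) ?_ ?_ ?_ ?_ ?_
  · intro u _
    rw [Finset.mem_filter, mem_nilradical_ofSubset]
    refine ⟨Finset.mem_univ _, fun i j hij => ?_⟩
    obtain ⟨i, rfl⟩ := e.surjective i
    obtain ⟨j, rfl⟩ := e.surjective j
    rcases i with i | i <;> rcases j with j | j <;> simp [T] at hij ⊢
  · intro _ _; exact Finset.mem_univ _
  · intro u _; simp
  · intro x hx
    rw [Finset.mem_filter, mem_nilradical_ofSubset] at hx
    ext i j
    obtain ⟨i, rfl⟩ := e.surjective i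
    obtain ⟨j, rfl⟩ := e.surjective j
    rcases i with i | i <;> rcases j with j | j <;> simp [toBlocks₁₂] <;>
      exact (hx.2 _ _ (by simp [T])).symm
  · intro u _
    rw [ev_eq f e]
    have : fromBlocks a u 0 d = fromBlocks a 0 0 d + fromBlocks 0 u 0 0 := by
      rw [fromBlocks_add]; simp
    rw [this]; rfl

/-- Two-block parabolics suffice. For `Y` the first step of the flag, the matrices with image in `Y`
that kill `Y` form an additive subgroup of the nilradical, and the sum over the nilradical already
vanishes on each of its cosets. A change of basis `b` moves `Y` to a coordinate subspace. -/
theorem isPreCuspidal_of_sum_eq_zero {f : InvFun F n}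
    (hf : ∀ k l, k + l = n → 0 < k → 0 < l → ∀ (a : Matrix (Fin k) (Fin k) F)
      (d : Matrix (Fin l) (Fin l) F),
      ∑ u : Matrix (Fin k) (Fin l) F, ev f (fromBlocks a u 0 d) = 0) : IsPreCuspidal f := by
  intro r hr D
  ext ⟨x, hx⟩
  have : NeZero r := ⟨by omega⟩
  set Y := D.W 0 with hY
  set k := Module.finrank F Y with hk
  have hkpos : 0 < k := by
    rw [hk, Module.finrank_pos_iff, Submodule.nontrivial_iff_ne_bot]
    exact D.ne_bot 0
  have hkn : k < n := by
    have h1 : Y < ⊤ := by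
      refine lt_top_iff_ne_top.2 fun htop => D.ne_bot ⟨1, hr⟩ ?_
      have h2 := D.isInternal.submodule_iSupIndep.pairwiseDisjoint
        (show (0 : Fin r) ≠ ⟨1, hr⟩ by
          intro h; have := congrArg Fin.val h; simp at this)
      have h3 : Disjoint Y (D.W ⟨1, hr⟩) := h2
      rw [htop] at h3
      exact top_disjoint.1 h3
    have h2 := Submodule.finrank_lt h1.ne
    rwa [Module.finrank_fin_fun] at h2
  obtain ⟨l, hl⟩ : ∃ l, k + l = n := ⟨n - k, by omega⟩
  obtain ⟨b, hb⟩ := exists_gl_map_coordSubspace (firstIndices n k) Y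
    (by rw [Fintype.card_congr (firstIndicesEquiv hl), Fintype.card_fin])
  have hb1 : b.val * b⁻¹.val = 1 := by rw [← Units.val_mul, mul_inv_cancel, Units.val_one]
  have hb' : ∀ v, v ∈ Y ↔ b⁻¹.val *ᵥ v ∈ coordSubspace F (firstIndices n k) := by
    intro v
    rw [← hb, mulVec_mulVec, hb1, one_mulVec]
  let e : Fin k ⊕ Fin l ≃ Fin n := finSumFinEquiv.trans (finCongr hl)
  have heL : ∀ a, firstIndices n k (e (Sum.inl a)) := fun a => by simp [e, firstIndices]
  have heR : ∀ a, ¬ firstIndices n k (e (Sum.inr a)) := fun a => by simp [e, firstIndices]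
  let N : Matrix (Fin k) (Fin l) F → Matrix (Fin n) (Fin n) F :=
    fun u => (fromBlocks 0 u 0 0).submatrix e.symm e.symm
  let U : Matrix (Fin k) (Fin l) F → Matrix (Fin n) (Fin n) F := fun u => b.val * N u * b⁻¹.val
  have hUY : ∀ u v, U u *ᵥ v ∈ Y := by
    intro u v
    have : U u *ᵥ v = b.val *ᵥ (N u *ᵥ (b⁻¹.val *ᵥ v)) := by
      simp only [U, mulVec_mulVec, Matrix.mul_assoc]
    rw [this, hb]
    intro i hi
    refine mulVec_apply_eq_zero fun j => ?_
    obtain ⟨i, rfl⟩ := e.surjective i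
    obtain ⟨j, rfl⟩ := e.surjective j
    rcases i with i | i
    · exact absurd (heL i) hi
    · rcases j with j | j <;> simp [N]
  have hU0 : ∀ u, ∀ v ∈ Y, U u *ᵥ v = 0 := by
    intro u v hv
    have : U u *ᵥ v = b.val *ᵥ (N u *ᵥ (b⁻¹.val *ᵥ v)) := by
      simp only [U, mulVec_mulVec, Matrix.mul_assoc]
    rw [this]
    have hz : N u *ᵥ (b⁻¹.val *ᵥ v) = 0 := by
      ext i
      refine mulVec_apply_eq_zero fun j => ?_
      obtain ⟨i, rfl⟩ := e.surjective i
      obtain ⟨j, rfl⟩ := e.surjective j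
      rcases j with j | j
      · rcases i with i | i <;> simp [N]
      · rw [(hb' v).1 hv _ (heR j), mul_zero]
    rw [hz, mulVec_zero]
  have hUnil : ∀ u, U u ∈ D.nilradical := by
    intro u i v hv
    by_cases hi : i = 0
    · subst hi
      have hle : (⨆ j ≤ (0 : Fin r), D.W j) ≤ Y := iSup₂_le fun j hj => by
        have : j = 0 := le_antisymm hj (Fin.zero_le _)
        subst this; exact le_rfl
      rw [hU0 u v (hle hv)]
      exact Submodule.zero_mem _
    · exact (le_iSup₂_of_le (f := fun j (_ : j < i) => D.W j) 0 (Fin.pos_iff_ne_zero.2 hi) le_rfl)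
        (hUY u v)
  have hnil_add : ∀ {y y'}, y ∈ D.nilradical → y' ∈ D.nilradical → y + y' ∈ D.nilradical := by
    intro y y' hy hy' i v hv
    rw [add_mulVec]
    exact Submodule.add_mem _ (hy i v hv) (hy' i v hv)
  have hUneg : ∀ u, U (-u) = - U u := by
    intro u
    have : N (-u) = - N u := by
      ext i j
      obtain ⟨i, rfl⟩ := e.surjective i
      obtain ⟨j, rfl⟩ := e.surjective j
      rcases i with i | i <;> rcases j with j | j <;> simp [N]
    simp only [U, this, Matrix.mul_neg, Matrix.neg_mul]
  change (Nat.card D.unipotentRadical : ℂ)⁻¹ *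
    ∑ y : Matrix (Fin n) (Fin n) F with y ∈ D.nilradical, f.1 (x + y) = 0
  rw [Finset.sum_filter]
  have hshift : ∀ u, ∑ y, (if y ∈ D.nilradical then f.1 (x + y) else 0) =
      ∑ y, (if y ∈ D.nilradical then f.1 (x + y + U u) else 0) := by
    intro u
    refine (Fintype.sum_equiv (Equiv.addRight (U u)) _ _ fun y => ?_).symm
    refine if_congr ⟨fun h => hnil_add h (hUnil u), fun h => ?_⟩ ?_ rfl
    · have := hnil_add h (hUnil (-u))
      rw [hUneg] at this
      simpa using this
    · simp [add_assoc]
  -- `x + y` preserves `Y`, so its conjugate `z` by `b⁻¹` is block upper triangular. Adding `U u`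
  -- only translates the upper right block of `z`, which the sum over `u` absorbs.
  have hinner : ∀ y ∈ D.nilradical, ∑ u, f.1 (x + y + U u) = 0 := by
    intro y hy
    set z := b⁻¹.val * (x + y) * b.val with hz
    have hzmem : z ∈ blockUpper F (firstIndices n k) := by
      refine mem_blockUpper_of_cols fun j hj => ?_
      have h1 : z.col j = b⁻¹.val *ᵥ ((x + y) *ᵥ (b.val *ᵥ Pi.single j 1)) := by
        rw [mulVec_mulVec, mulVec_mulVec, ← hz, mulVec_single_one]
      rw [h1, ← hb']
      have h2 : b.val *ᵥ Pi.single j 1 ∈ Y := (hb _).2 fun m hm =>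
        Pi.single_eq_of_ne (by rintro rfl; exact hm hj) _
      rw [add_mulVec]
      refine Submodule.add_mem _ (hx 0 _ h2) ?_
      have h3 := hy 0 _ ((le_iSup₂_of_le (f := fun j (_ : j ≤ (0 : Fin r)) => D.W j) 0 le_rfl
        le_rfl) h2)
      have h4 : (⨆ j < (0 : Fin r), D.W j) ≤ Y :=
        iSup₂_le fun j hj => absurd hj (Fin.not_lt_zero j)
      exact h4 h3
    have h5 := hf k l hl hkpos (by omega) (z.submatrix e e).toBlocks₁₁ (z.submatrix e e).toBlocks₂₂
    rw [← h5]
    refine Fintype.sum_equiv (Equiv.addLeft (z.submatrix e e).toBlocks₁₂) _ _ fun u => ?_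
    have h6 : x + y + U u = b.val * (z + N u) * b⁻¹.val := by
      have : x + y = b.val * z * b⁻¹.val := by
        rw [hz]
        calc x + y = (b.val * b⁻¹.val) * (x + y) * (b.val * b⁻¹.val) := by simp
          _ = _ := by simp only [Matrix.mul_assoc]
      rw [this, Matrix.mul_add, Matrix.add_mul]
    rw [h6, f.2, ev_eq f e]
    refine congrArg f.1 (Matrix.ext fun i j => ?_)
    obtain ⟨i, rfl⟩ := e.surjective i
    obtain ⟨j, rfl⟩ := e.surjective j
    rcases i with i | i <;> rcases j with j | j <;>
      simp [N, toBlocks₁₁, toBlocks₁₂, toBlocks₂₂]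
    exact hzmem _ _ (heR i) (heL j)
  -- The sum is multiplied by the number of matrices `u`, each copy is shifted by `U u`, and the
  -- order of summation is exchanged.
  have hcard : (Fintype.card (Matrix (Fin k) (Fin l) F) : ℂ) ≠ 0 :=
    Nat.cast_ne_zero.2 Fintype.card_ne_zero
  refine mul_eq_zero_of_right _ ((mul_eq_zero.1 (?_ : (Fintype.card (Matrix (Fin k) (Fin l) F) : ℂ) *
    _ = 0)).resolve_left hcard)
  rw [← nsmul_eq_mul, ← Finset.card_univ, ← Finset.sum_const,
    Finset.sum_congr rfl fun u _ => hshift u, Finset.sum_comm]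
  refine Finset.sum_eq_zero fun y _ => ?_
  split_ifs with hy
  · exact hinner y hy
  · exact Finset.sum_const_zero

theorem isPreCuspidal_iff_pairing {f : InvFun F n} :
    IsPreCuspidal f ↔ ∀ k l (h : k + l = n), 0 < k → 0 < l → ∀ (f₁ : InvFun F k) (f₂ : InvFun F l),
      pairing F n (hcProd h f₁ f₂) f = 0 := by
  constructor
  · intro hf k l h hk hl
    rw [pairing_hcProd_eq_zero_iff]
    intro a d
    have : NeZero k := ⟨hk.ne'⟩
    have : NeZero l := ⟨hl.ne'⟩
    exact sum_ev_fromBlocks_eq_zero hf (finSumFinEquiv.trans (finCongr h)) a d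
  · intro hf
    exact isPreCuspidal_of_sum_eq_zero fun k l h hk hl =>
      (pairing_hcProd_eq_zero_iff h f).1 (hf k l h hk hl)

end InvFun

/-! ### Pre-cuspidal functions as generators, and associativity of the product -/

namespace InvFun

open Matrix

variable {F : Type*} [Field F] {n : ℕ}

theorem conj_add (f g : InvFun F n) : conj (f + g) = conj f + conj g := by
  ext x; simp [conj]

theorem conj_smul (c : ℂ) (f : InvFun F n) : conj (c • f) = star c • conj f := by
  ext x; simp [conj]

theorem conj_zero : conj (0 : InvFun F n) = 0 := by
  ext x; simp [conj]

theorem conj_mem_span {s : Set (InvFun F n)} (hs : ∀ f ∈ s, conj f ∈ s) {f : InvFun F n}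
    (hf : f ∈ Submodule.span ℂ s) : conj f ∈ Submodule.span ℂ s := by
  induction hf using Submodule.span_induction with
  | mem x hx => exact Submodule.subset_span (hs x hx)
  | zero => rw [conj_zero]; exact Submodule.zero_mem _
  | add x y _ _ hx hy => rw [conj_add]; exact Submodule.add_mem _ hx hy
  | smul c x _ hx => rw [conj_smul]; exact Submodule.smul_mem _ _ hx

variable [Fintype F] {k l m : ℕ}

theorem conj_hcProd (h : k + l = n) (f : InvFun F k) (g : InvFun F l) :
    conj (hcProd h f g) = hcProd h (conj f) (conj g) := by
  subst h
  ext x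
  rw [hcProd_rfl, hcProd_rfl]
  simp [conj, hcInd, boxProd]

theorem isPreCuspidal_conj {f : InvFun F n} (hf : IsPreCuspidal f) : IsPreCuspidal (conj f) := by
  rw [isPreCuspidal_iff_pairing] at hf ⊢
  intro k l h hk hl f₁ f₂
  have h1 := congrArg star (hf k l h hk hl (conj f₁) (conj f₂))
  rw [← conj_hcProd, star_zero] at h1
  rw [← h1]
  simp [pairing_apply, conj]

/-- The span of the products of functions of positive degree. -/
def decomposables (F : Type*) [Field F] [Fintype F] (n : ℕ) : Submodule ℂ (InvFun F n) :=
  Submodule.span ℂ {f | ∃ (k l : ℕ) (h : k + l = n), 0 < k ∧ 0 < l ∧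
    ∃ (f₁ : InvFun F k) (f₂ : InvFun F l), f = hcProd h f₁ f₂}

/-- Conjugating a product conjugates its factors, so the decomposables are conjugation-stable. By
positivity they meet their orthogonal trivially, hence are complementary to it, and that orthogonal
consists of pre-cuspidal functions. -/
theorem exists_isPreCuspidal_add (f : InvFun F n) :
    ∃ p d, IsPreCuspidal p ∧ d ∈ decomposables F n ∧ f = p + d := by
  have hrefl : (pairing F n).IsRefl := fun x y h => by rw [pairing_comm]; exact h
  have hdisj : Disjoint (decomposables F n) ((pairing F n).orthogonal (decomposables F n)) := by
    refine Submodule.disjoint_def.2 fun x hx hx' => eq_zero_of_pairing_conj x ?_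
    rw [pairing_comm]
    refine hx' _ (conj_mem_span ?_ hx)
    rintro _ ⟨k, l, h, hk, hl, f₁, f₂, rfl⟩
    exact ⟨k, l, h, hk, hl, conj f₁, conj f₂, conj_hcProd h f₁ f₂⟩
  have hcompl := (LinearMap.BilinForm.isCompl_orthogonal_iff_disjoint hrefl).2 hdisj
  have hf : f ∈ decomposables F n ⊔ (pairing F n).orthogonal (decomposables F n) := by
    rw [hcompl.sup_eq_top]; trivial
  obtain ⟨d, hd, p, hp, rfl⟩ := Submodule.mem_sup.1 hf
  refine ⟨p, d, ?_, hd, add_comm _ _⟩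
  rw [isPreCuspidal_iff_pairing]
  intro k l h hk hl f₁ f₂
  exact hp _ (Submodule.subset_span ⟨k, l, h, hk, hl, f₁, f₂, rfl⟩)

/-- Harish-Chandra restriction (up to normalisation) evaluated at a fixed second block. -/
noncomputable def sliceLeft (k : ℕ) (φ : InvFun F n) {β : Type*} [Fintype β] [DecidableEq β]
    (d : Matrix β β F) : InvFun F k :=
  ⟨fun a => ∑ u : Matrix (Fin k) β F, ev φ (fromBlocks a u 0 d), fun g a => by
    have := sum_ev_fromBlocks_conj φ g (1 : GL β F) a d
    simpa using this⟩

/-- Harish-Chandra restriction (up to normalisation) evaluated at a fixed first block. -/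
noncomputable def sliceRight (l : ℕ) (φ : InvFun F n) {α : Type*} [Fintype α] [DecidableEq α]
    (a : Matrix α α F) : InvFun F l :=
  ⟨fun d => ∑ u : Matrix α (Fin l) F, ev φ (fromBlocks a u 0 d), fun g d => by
    have := sum_ev_fromBlocks_conj φ (1 : GL α F) g a d
    simpa using this⟩

theorem ev_sliceLeft (φ : InvFun F n) {α β : Type*} [Fintype α] [DecidableEq α]
    [Fintype β] [DecidableEq β] (e : α ≃ Fin k) (a : Matrix α α F) (d : Matrix β β F) :
    ev (sliceLeft k φ d) a = ∑ u : Matrix α β F, ev φ (fromBlocks a u 0 d) := by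
  rw [ev_eq _ e]
  refine (Fintype.sum_equiv (Matrix.reindex e (Equiv.refl β)) _ _ fun u => ?_).symm
  rw [← ev_submatrix φ (Equiv.sumCongr e.symm (Equiv.refl β))]
  refine congrArg (ev φ) (Matrix.ext fun i j => ?_)
  rcases i with i | i <;> rcases j with j | j <;> simp

theorem ev_sliceRight (φ : InvFun F n) {α β : Type*} [Fintype α] [DecidableEq α]
    [Fintype β] [DecidableEq β] (e : β ≃ Fin l) (a : Matrix α α F) (d : Matrix β β F) :
    ev (sliceRight l φ a) d = ∑ u : Matrix α β F, ev φ (fromBlocks a u 0 d) := by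
  rw [ev_eq _ e]
  refine (Fintype.sum_equiv (Matrix.reindex (Equiv.refl α) e) _ _ fun u => ?_).symm
  rw [← ev_submatrix φ (Equiv.sumCongr (Equiv.refl α) e.symm)]
  refine congrArg (ev φ) (Matrix.ext fun i j => ?_)
  rcases i with i | i <;> rcases j with j | j <;> simp

theorem exists_pairing_hcProd_sliceLeft (F : Type*) [Field F] [Fintype F] {k l n : ℕ}
    (h : k + l = n) : ∃ c : ℂ, c ≠ 0 ∧ ∀ (f : InvFun F k) (g : InvFun F l) (φ : InvFun F n),
      pairing F n (hcProd h f g) φ = c * ∑ d, g.1 d * pairing F k f (sliceLeft k φ d) := by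
  obtain ⟨c, hc, H⟩ := exists_pairing_hcProd_fromBlocks F h
  refine ⟨c, hc, fun f g φ => ?_⟩
  rw [H]
  simp only [pairing_apply, sliceLeft, Finset.mul_sum]
  rw [Finset.sum_comm' (t' := Finset.univ) (s' := fun _ => Finset.univ) (by simp)]
  rw [Finset.sum_congr rfl fun u _ => Finset.sum_comm]
  rw [Finset.sum_comm]
  refine Finset.sum_congr rfl fun d _ => ?_
  rw [Finset.sum_comm]
  refine Finset.sum_congr rfl fun a _ => Finset.sum_congr rfl fun u _ => ?_
  ring

theorem exists_pairing_hcProd_sliceRight (F : Type*) [Field F] [Fintype F] {k l n : ℕ}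
    (h : k + l = n) : ∃ c : ℂ, c ≠ 0 ∧ ∀ (f : InvFun F k) (g : InvFun F l) (φ : InvFun F n),
      pairing F n (hcProd h f g) φ = c * ∑ a, f.1 a * pairing F l g (sliceRight l φ a) := by
  obtain ⟨c, hc, H⟩ := exists_pairing_hcProd_fromBlocks F h
  refine ⟨c, hc, fun f g φ => ?_⟩
  rw [H]
  simp only [pairing_apply, sliceRight, Finset.mul_sum]
  refine Finset.sum_congr rfl fun a _ => ?_
  rw [Finset.sum_comm]
  refine Finset.sum_congr rfl fun d _ => Finset.sum_congr rfl fun u _ => ?_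
  ring

theorem exists_pairing_hcProd_hcProd (F : Type*) [Field F] [Fintype F] {k l m a n : ℕ}
    (h₁ : k + l = a) (h₂ : a + m = n) :
    ∃ c : ℂ, c ≠ 0 ∧ ∀ (f : InvFun F k) (g : InvFun F l) (w : InvFun F m) (φ : InvFun F n),
      pairing F n (hcProd h₂ (hcProd h₁ f g) w) φ =
        c * ∑ x, ∑ y, ∑ d, f.1 x * g.1 y * w.1 d *
          ∑ v : Matrix (Fin k) (Fin l) F, ∑ u : Matrix (Fin k ⊕ Fin l) (Fin m) F,
            ev φ (fromBlocks (fromBlocks x v 0 y) u 0 d) := by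
  obtain ⟨c₁, hc₁, H₁⟩ := exists_pairing_hcProd_fromBlocks F h₁
  obtain ⟨c₂, hc₂, H₂⟩ := exists_pairing_hcProd_sliceLeft F h₂
  refine ⟨c₂ * c₁, mul_ne_zero hc₂ hc₁, fun f g w φ => ?_⟩
  rw [H₂, mul_assoc]
  simp only [H₁, ev_sliceLeft φ (finSumFinEquiv.trans (finCongr h₁)), mul_left_comm _ c₁,
    ← Finset.mul_sum]
  congr 2
  simp only [Finset.mul_sum]
  rw [Finset.sum_comm]
  refine Finset.sum_congr rfl fun x _ => ?_
  rw [Finset.sum_congr rfl fun d _ => Finset.sum_comm, Finset.sum_comm]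
  refine Finset.sum_congr rfl fun y _ => Finset.sum_congr rfl fun d _ =>
    Finset.sum_congr rfl fun v _ => Finset.sum_congr rfl fun u _ => ?_
  ring

theorem exists_pairing_hcProd_hcProd' (F : Type*) [Field F] [Fintype F] {k l m b n : ℕ}
    (h₁ : l + m = b) (h₂ : k + b = n) :
    ∃ c : ℂ, c ≠ 0 ∧ ∀ (f : InvFun F k) (g : InvFun F l) (w : InvFun F m) (φ : InvFun F n),
      pairing F n (hcProd h₂ f (hcProd h₁ g w)) φ =
        c * ∑ x, ∑ y, ∑ d, f.1 x * g.1 y * w.1 d *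
          ∑ v : Matrix (Fin l) (Fin m) F, ∑ u : Matrix (Fin k) (Fin l ⊕ Fin m) F,
            ev φ (fromBlocks x u 0 (fromBlocks y v 0 d)) := by
  obtain ⟨c₁, hc₁, H₁⟩ := exists_pairing_hcProd_fromBlocks F h₁
  obtain ⟨c₂, hc₂, H₂⟩ := exists_pairing_hcProd_sliceRight F h₂
  refine ⟨c₂ * c₁, mul_ne_zero hc₂ hc₁, fun f g w φ => ?_⟩
  rw [H₂, mul_assoc]
  simp only [H₁, ev_sliceRight φ (finSumFinEquiv.trans (finCongr h₁)), mul_left_comm _ c₁,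
    ← Finset.mul_sum]
  congr 2
  simp only [Finset.mul_sum]
  refine Finset.sum_congr rfl fun x _ => Finset.sum_congr rfl fun y _ => ?_
  rw [Finset.sum_comm]
  refine Finset.sum_congr rfl fun d _ =>
    Finset.sum_congr rfl fun v _ => Finset.sum_congr rfl fun u _ => ?_
  ring

/-- Both sides run over the same 3 × 3 block upper triangular matrices with fixed diagonal; only the
grouping of the three blocks above the diagonal differs. -/
theorem sum_ev_fromBlocks_assoc (φ : InvFun F n) {α β γ : Type*} [Fintype α] [DecidableEq α]
    [Fintype β] [DecidableEq β] [Fintype γ] [DecidableEq γ] (x : Matrix α α F) (y : Matrix β β F)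
    (d : Matrix γ γ F) :
    ∑ v : Matrix α β F, ∑ u : Matrix (α ⊕ β) γ F, ev φ (fromBlocks (fromBlocks x v 0 y) u 0 d) =
      ∑ v : Matrix β γ F, ∑ u : Matrix α (β ⊕ γ) F,
        ev φ (fromBlocks x u 0 (fromBlocks y v 0 d)) := by
  rw [← Fintype.sum_prod_type', ← Fintype.sum_prod_type']
  let E : Matrix α β F × Matrix (α ⊕ β) γ F ≃ Matrix β γ F × Matrix α (β ⊕ γ) F :=
    { toFun := fun p => (p.2.toRows₂, fromCols p.1 p.2.toRows₁)
      invFun := fun p => (p.2.toCols₁, fromRows p.2.toCols₂ p.1)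
      left_inv := fun p => by simp
      right_inv := fun p => by simp }
  refine Fintype.sum_equiv E _ _ fun p => ?_
  rw [← ev_submatrix φ (Equiv.sumAssoc α β γ)]
  refine congrArg (ev φ) (Matrix.ext fun i j => ?_)
  rcases i with (i | i) | i <;> rcases j with (j | j) | j <;> rfl

/-- Harish-Chandra induction is associative up to a scalar. -/
theorem exists_hcProd_assoc (F : Type*) [Field F] [Fintype F] {k l m a b n : ℕ}
    (h₁ : k + l = a) (h₂ : a + m = n) (h₃ : l + m = b) (h₄ : k + b = n) :
    ∃ c : ℂ, ∀ (f : InvFun F k) (g : InvFun F l) (w : InvFun F m),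
      hcProd h₂ (hcProd h₁ f g) w = c • hcProd h₄ f (hcProd h₃ g w) := by
  obtain ⟨c, hc, H⟩ := exists_pairing_hcProd_hcProd F h₁ h₂
  obtain ⟨c', hc', H'⟩ := exists_pairing_hcProd_hcProd' F h₃ h₄
  refine ⟨c * c'⁻¹, fun f g w => eq_of_pairing fun φ => ?_⟩
  rw [map_smul, LinearMap.smul_apply, H, H', smul_eq_mul, mul_assoc, inv_mul_cancel_left₀ hc']
  simp only [sum_ev_fromBlocks_assoc]

theorem exists_hcProd_zero_left (h : 0 + n = n) (f : InvFun F 0) (g : InvFun F n) :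
    ∃ c : ℂ, hcProd h f g = c • g := by
  obtain ⟨c, hc, H⟩ := exists_pairing_hcProd_fromBlocks F h
  refine ⟨c * f.1 0, eq_of_pairing fun φ => ?_⟩
  rw [H, map_smul, LinearMap.smul_apply, smul_eq_mul, mul_assoc, Fintype.sum_subsingleton _ 0,
    Fintype.sum_subsingleton _ 0, pairing_apply]
  simp only [Finset.mul_sum]
  refine Finset.sum_congr rfl fun d _ => ?_
  rw [mul_assoc, ← ev_submatrix φ (Equiv.emptySum (Fin 0) (Fin n)).symm, ← ev_fin φ]
  refine congrArg _ (congrArg _ (congrArg _ (congrArg (ev φ) (Matrix.ext fun i j => ?_))))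
  simp

/-- Needed to view a single pre-cuspidal function as a one-letter word, since words end in a degree
0 factor. -/
theorem exists_hcProd_zero_right (h : n + 0 = n) (f : InvFun F n) :
    ∃ (c : ℂ) (g : InvFun F 0), f = c • hcProd h f g := by
  obtain ⟨c, hc, H⟩ := exists_pairing_hcProd_fromBlocks F h
  refine ⟨c⁻¹, ⟨fun _ => 1, fun _ _ => rfl⟩, eq_of_pairing fun φ => ?_⟩
  rw [map_smul, LinearMap.smul_apply, smul_eq_mul, H, inv_mul_cancel_left₀ hc, pairing_apply]
  refine Finset.sum_congr rfl fun d _ => ?_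
  rw [Fintype.sum_subsingleton _ 0, Fintype.sum_subsingleton _ 0, mul_one,
    ← ev_submatrix φ (Equiv.sumEmpty (Fin n) (Fin 0)).symm, ← ev_fin φ]
  refine congrArg _ (congrArg (ev φ) (Matrix.ext fun i j => ?_))
  simp

/-! ### Words in pre-cuspidal functions and their parity -/

/-- Iterated products of pre-cuspidal functions of positive degree, with the sign `-1` for each
factor. -/
inductive SignedWord (F : Type*) [Field F] [Fintype F] : (n : ℕ) → ℤˣ → InvFun F n → Prop
  | unit (f : InvFun F 0) : SignedWord F 0 1 f
  | cons {k l n : ℕ} (h : k + l = n) (hk : 0 < k) {p : InvFun F k} (hp : IsPreCuspidal p)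
      {s : ℤˣ} {g : InvFun F l} (hg : SignedWord F l s g) : SignedWord F n (-s) (hcProd h p g)

/-- The span of the words with a given sign. -/
def signPart (F : Type*) [Field F] [Fintype F] (n : ℕ) (s : ℤˣ) : Submodule ℂ (InvFun F n) :=
  Submodule.span ℂ {f | SignedWord F n s f}

theorem SignedWord.conj {s : ℤˣ} {f : InvFun F n} (hf : SignedWord F n s f) :
    SignedWord F n s (conj f) := by
  induction hf with
  | unit f => exact .unit _
  | cons h hk hp hg ih => rw [conj_hcProd]; exact .cons h hk (isPreCuspidal_conj hp) ih

theorem conj_mem_signPart {s : ℤˣ} {f : InvFun F n} (hf : f ∈ signPart F n s) :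
    conj f ∈ signPart F n s :=
  conj_mem_span (fun _ h => SignedWord.conj h) hf

theorem hcProd_mem_signPart_neg (h : k + l = n) (hk : 0 < k) {p : InvFun F k}
    (hp : IsPreCuspidal p) {s : ℤˣ} {g : InvFun F l} (hg : g ∈ signPart F l s) :
    hcProd h p g ∈ signPart F n (-s) := by
  have : signPart F l s ≤ (signPart F n (-s)).comap (hcProd h p) :=
    Submodule.span_le.2 fun g hg => Submodule.subset_span (.cons h hk hp hg)
  exact this hg

theorem mem_signPart_of_isPreCuspidal (hn : 0 < n) {p : InvFun F n} (hp : IsPreCuspidal p) :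
    p ∈ signPart F n (-1) := by
  obtain ⟨c, g, hg⟩ := exists_hcProd_zero_right (add_zero n) p
  rw [hg]
  exact Submodule.smul_mem _ _
    (hcProd_mem_signPart_neg _ hn hp (Submodule.subset_span (.unit g)))

theorem hcProd_mem_signPart (h : k + l = n) {s t : ℤˣ} {f : InvFun F k} (hf : f ∈ signPart F k s)
    {g : InvFun F l} (hg : g ∈ signPart F l t) : hcProd h f g ∈ signPart F n (s * t) := by
  have : signPart F k s ≤ (signPart F n (s * t)).comap ((hcProd h).flip g) := by
    clear hf f
    refine Submodule.span_le.2 fun f hf => ?_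
    change hcProd h f g ∈ signPart F n (s * t)
    induction hf generalizing n with
    | unit f =>
      obtain rfl : l = n := by omega
      obtain ⟨c, hc⟩ := exists_hcProd_zero_left h f g
      rw [hc, one_mul]
      exact Submodule.smul_mem _ _ hg
    | cons h' hk hp _ ih =>
      -- Reassociating moves the first letter outside, leaving a shorter left word to which the
      -- induction applies. The scalar is harmless in a span.
      obtain ⟨c, hc⟩ := exists_hcProd_assoc F h' h rfl (by omega)
      rw [hc, neg_mul]
      exact Submodule.smul_mem _ _ (hcProd_mem_signPart_neg _ hk hp (ih rfl))
  exact this hf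

/-- By induction on the degree: the pre-cuspidal part is a one-letter word, and products of
smaller-degree functions expand into products of signed parts. -/
theorem signPart_sup (F : Type*) [Field F] [Fintype F] (n : ℕ) :
    signPart F n 1 ⊔ signPart F n (-1) = ⊤ := by
  induction n using Nat.strong_induction_on with
  | _ n ih =>
    refine Submodule.eq_top_iff'.2 fun f => ?_
    rcases Nat.eq_zero_or_pos n with rfl | hn
    · exact Submodule.mem_sup_left (Submodule.subset_span (.unit f))
    obtain ⟨p, d, hp, hd, rfl⟩ := exists_isPreCuspidal_add f
    refine Submodule.add_mem _ (Submodule.mem_sup_right (mem_signPart_of_isPreCuspidal hn hp)) ?_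
    refine (Submodule.span_le.2 ?_ : decomposables F n ≤ _) hd
    rintro _ ⟨k, l, h, hk, hl, f₁, f₂, rfl⟩
    have h₁ : f₁ ∈ signPart F k 1 ⊔ signPart F k (-1) := by rw [ih k (by omega)]; trivial
    have h₂ : f₂ ∈ signPart F l 1 ⊔ signPart F l (-1) := by rw [ih l (by omega)]; trivial
    obtain ⟨a, ha, b, hb, rfl⟩ := Submodule.mem_sup.1 h₁
    obtain ⟨c, hc, d, hd, rfl⟩ := Submodule.mem_sup.1 h₂
    simp only [map_add, LinearMap.add_apply]
    have h11 := hcProd_mem_signPart h ha hc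
    have h12 := hcProd_mem_signPart h ha hd
    have h21 := hcProd_mem_signPart h hb hc
    have h22 := hcProd_mem_signPart h hb hd
    simp only [mul_one, mul_neg, neg_neg] at h11 h12 h21 h22
    exact Submodule.add_mem _
      (Submodule.add_mem _ (Submodule.mem_sup_left h11) (Submodule.mem_sup_right h21))
      (Submodule.add_mem _ (Submodule.mem_sup_right h12) (Submodule.mem_sup_left h22))

end InvFun

/-! ### Mackey contributions of a pair of coordinate subspaces -/

namespace InvFun

open Matrix

variable {F : Type*} [Field F] {n : ℕ}

theorem ev_sum {κ : Type*} (s : Finset κ) (f : κ → InvFun F n) {α : Type*} (x : Matrix α α F) :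
    ev (∑ i ∈ s, f i) x = ∑ i ∈ s, ev (f i) x := by
  unfold ev
  split_ifs <;> simp

variable [Fintype F] {k l k' l' : ℕ} {ι : Type*} [Fintype ι]
  [DecidableEq ι]

/-- The contribution of a pair of coordinate subspaces to the pairing of two products. -/
noncomputable def relativeSum (S S' : ι → Prop) (p : InvFun F k) (g : InvFun F l)
    (r : InvFun F k') (h : InvFun F l') : ℂ :=
  ∑ x : Matrix ι ι F, if x ∈ blockUpper F S ∧ x ∈ blockUpper F S' then
    (ev p (x.toBlock S S) * ev g (x.toBlock (fun i => ¬ S i) fun i => ¬ S i)) *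
    (ev r (x.toBlock S' S') * ev h (x.toBlock (fun i => ¬ S' i) fun i => ¬ S' i)) else 0

theorem relativeSum_comm (S S' : ι → Prop) (p : InvFun F k) (g : InvFun F l)
    (r : InvFun F k') (h : InvFun F l') :
    relativeSum S S' p g r h = relativeSum S' S r h p g :=
  Finset.sum_congr rfl fun _ _ => if_congr and_comm (mul_comm _ _) rfl

/-- Translate `x` by matrices `E u` with rows in S ∩ S' and columns in S \ S'. This preserves both
parabolics and changes only the block seen by `p`. Stability of S' makes that block upper triangular
for S = (S ∩ S') ⊔ (S \ S'), so the sum over `u` is one of the coset sums killed by pre-cuspidality.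
-/
theorem relativeSum_eq_zero_of_inter {S S' : ι → Prop} {p : InvFun F k} (hp : IsPreCuspidal p)
    (g : InvFun F l) (r : InvFun F k') (h : InvFun F l') (e : {i // S i} ≃ Fin k)
    (h₁ : ∃ i, S i ∧ S' i) (h₂ : ∃ i, S i ∧ ¬ S' i) : relativeSum S S' p g r h = 0 := by
  let A := {i : ι // S i ∧ S' i}
  let B := {i : ι // S i ∧ ¬ S' i}
  have : Nonempty A := nonempty_subtype.2 h₁
  have : Nonempty B := nonempty_subtype.2 h₂
  let E : Matrix A B F → Matrix ι ι F := fun u i j =>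
    if hij : (S i ∧ S' i) ∧ (S j ∧ ¬ S' j) then u ⟨i, hij.1⟩ ⟨j, hij.2⟩ else 0
  have hE : ∀ u i j, ¬ ((S i ∧ S' i) ∧ (S j ∧ ¬ S' j)) → E u i j = 0 := fun u i j hij => dif_neg hij
  have hES : ∀ u x, x + E u ∈ blockUpper F S ↔ x ∈ blockUpper F S := by
    intro u x
    refine forall_congr' fun i => forall_congr' fun j => forall_congr' fun hi =>
      forall_congr' fun hj => ?_
    rw [Matrix.add_apply, hE u i j (by tauto), add_zero]
  have hES' : ∀ u x, x + E u ∈ blockUpper F S' ↔ x ∈ blockUpper F S' := by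
    intro u x
    refine forall_congr' fun i => forall_congr' fun j => forall_congr' fun hi =>
      forall_congr' fun hj => ?_
    rw [Matrix.add_apply, hE u i j (by tauto), add_zero]
  have h1 : ∀ u x, (x + E u).toBlock (fun i => ¬ S i) (fun i => ¬ S i) =
      x.toBlock (fun i => ¬ S i) (fun i => ¬ S i) := by
    intro u x; ext i j
    rw [toBlock_apply, Matrix.add_apply, hE u i j (fun h => i.2 h.1.1), add_zero, toBlock_apply]
  have h2 : ∀ u x, (x + E u).toBlock (fun i => ¬ S' i) (fun i => ¬ S' i) =
      x.toBlock (fun i => ¬ S' i) (fun i => ¬ S' i) := by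
    intro u x; ext i j
    rw [toBlock_apply, Matrix.add_apply, hE u i j (fun h => i.2 h.1.2), add_zero, toBlock_apply]
  have h3 : ∀ u x, (x + E u).toBlock S' S' = x.toBlock S' S' := by
    intro u x; ext i j
    rw [toBlock_apply, Matrix.add_apply, hE u i j (fun h => h.2.2 j.2), add_zero, toBlock_apply]
  let c : A ⊕ B ≃ {i // S i} :=
    { toFun := Sum.elim (fun a => ⟨a.1, a.2.1⟩) (fun b => ⟨b.1, b.2.1⟩)
      invFun := fun i => if hi : S' i.1 then Sum.inl ⟨i.1, i.2, hi⟩ else Sum.inr ⟨i.1, i.2, hi⟩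
      left_inv := by
        rintro (⟨a, ha⟩ | ⟨b, hb⟩)
        · simp [ha]
        · simp [hb]
      right_inv := fun i => by by_cases hi : S' i.1 <;> simp [hi] }
  have h4 : ∀ x ∈ blockUpper F S', ∑ u, ev p ((x + E u).toBlock S S) = 0 := by
    intro x hx
    let y := (x.toBlock S S).submatrix c c
    rw [← sum_ev_fromBlocks_eq_zero hp (c.trans e) y.toBlocks₁₁ y.toBlocks₂₂]
    refine Fintype.sum_equiv (Equiv.addLeft y.toBlocks₁₂) _ _ fun u => ?_
    rw [← ev_submatrix p c]
    refine congrArg (ev p) (Matrix.ext fun i j => ?_)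
    rcases i with i | i <;> rcases j with j | j
    · change x i.1 j.1 + E u i.1 j.1 = x i.1 j.1
      rw [hE u i.1 j.1 fun h => h.2.2 j.2.2, add_zero]
    · change x i.1 j.1 + E u i.1 j.1 = x i.1 j.1 + u i j
      exact congrArg _ (dif_pos ⟨i.2, j.2⟩)
    · change x i.1 j.1 + E u i.1 j.1 = 0
      rw [hE u i.1 j.1 fun h => h.2.2 j.2.2, add_zero, hx i.1 j.1 i.2.2 j.2.2]
    · change x i.1 j.1 + E u i.1 j.1 = x i.1 j.1
      rw [hE u i.1 j.1 fun h => i.2.2 h.1.2, add_zero]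
  have hcard : (Fintype.card (Matrix A B F) : ℂ) ≠ 0 := Nat.cast_ne_zero.2 Fintype.card_ne_zero
  refine (mul_eq_zero.1 (?_ : (Fintype.card (Matrix A B F) : ℂ) * _ = 0)).resolve_left hcard
  rw [← nsmul_eq_mul, ← Finset.card_univ, ← Finset.sum_const, relativeSum,
    Finset.sum_congr rfl fun u _ => (Fintype.sum_equiv (Equiv.addRight (E u)) _ _ fun _ => rfl).symm,
    Finset.sum_comm]
  refine Finset.sum_eq_zero fun x _ => ?_
  simp only [Equiv.coe_addRight, hES, hES', h1, h2, h3]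
  split_ifs with hx
  · rw [← Finset.sum_mul, ← Finset.sum_mul, h4 x hx.2, zero_mul, zero_mul]
  · exact Finset.sum_const_zero

theorem relativeSum_self_eq_zero {S : ι → Prop} (p : InvFun F k) {g : InvFun F l}
    (r : InvFun F k) {h : InvFun F l} (e : {i // ¬ S i} ≃ Fin l) (hgh : pairing F l g h = 0) :
    relativeSum S S p g r h = 0 := by
  rw [relativeSum]
  simp only [and_self]
  rw [sum_ite_mem_blockUpper (Equiv.sumCompl S) (fun a => a.2) (fun b => b.2)]
  refine Finset.sum_eq_zero fun a _ => Finset.sum_eq_zero fun u _ => ?_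
  have h1 : ∀ d, ((fromBlocks a u 0 d).submatrix (Equiv.sumCompl S).symm
      (Equiv.sumCompl S).symm).toBlock S S = a := by
    intro d; ext i j; simp [toBlock_apply]
  have h2 : ∀ d, ((fromBlocks a u 0 d).submatrix (Equiv.sumCompl S).symm
      (Equiv.sumCompl S).symm).toBlock (fun i => ¬ S i) (fun i => ¬ S i) = d := by
    intro d; ext i j
    simp [toBlock_apply, Equiv.sumCompl_symm_apply_of_neg, i.2, j.2]
  simp only [h1, h2]
  rw [pairing_eq_sum_ev _ _ e] at hgh
  calc _ = ev p a * ev r a * ∑ d, ev g d * ev h d := by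
        rw [Finset.mul_sum]; exact Finset.sum_congr rfl fun d _ => by ring
    _ = 0 := by rw [hgh, mul_zero]

/-- The adjoint, up to a scalar, of multiplication by `r`. -/
noncomputable def skew (z : ℕ) (r : InvFun F k) (g : InvFun F l) : InvFun F z :=
  ∑ c : Matrix (Fin k) (Fin k) F, r.1 c • sliceRight z g c

theorem ev_skew {α β : Type*} [Fintype α] [DecidableEq α] [Fintype β] [DecidableEq β] {z : ℕ}
    (a : α ≃ Fin k) (b : β ≃ Fin z) (r : InvFun F k) (g : InvFun F l) (d : Matrix β β F) :
    ev (skew z r g) d = ∑ c : Matrix α α F, ∑ u : Matrix α β F,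
      ev r c * ev g (fromBlocks c u 0 d) := by
  rw [skew, ev_sum]
  refine (Fintype.sum_equiv (Matrix.reindex a a) _ _ fun c => ?_).symm
  rw [ev_smul, ev_sliceRight g b, ev_eq r a, Finset.mul_sum]
  refine Fintype.sum_equiv (Matrix.reindex a (Equiv.refl β)) _ _ fun u => ?_
  rw [← ev_submatrix g (Equiv.sumCongr a.symm (Equiv.refl β))]
  refine congrArg _ (congrArg (ev g) (Matrix.ext fun i j => ?_))
  rcases i with i | i <;> rcases j with j | j <;> simp

theorem exists_pairing_skew (F : Type*) [Field F] [Fintype F] {k l n : ℕ} (h : k + l = n) :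
    ∃ c : ℂ, c ≠ 0 ∧ ∀ (r : InvFun F k) (f : InvFun F l) (g : InvFun F n),
      pairing F n (hcProd h r f) g = c * pairing F l f (skew l r g) := by
  obtain ⟨c, hc, H⟩ := exists_pairing_hcProd_sliceRight F h
  refine ⟨c, hc, fun r f g => ?_⟩
  rw [H, skew, map_sum]
  simp only [map_smul, smul_eq_mul]

/-- Split the indices into A = S, B = S' and the rest C. Stability under both subspaces leaves the
diagonal blocks and the blocks (A, C) and (B, C). Then `p` and `h` share the A block, `r` and `g`
share the B block, and `g` and `h` share the C block `d`. For fixed `d` the sum therefore splits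
into the two values of `skew` at `d`. -/
theorem relativeSum_of_disjoint {S S' : ι → Prop} (hd : ∀ i, ¬ (S i ∧ S' i)) (p : InvFun F k)
    (g : InvFun F l) (r : InvFun F k') (h : InvFun F l') {z : ℕ} (e : {i // S i} ≃ Fin k)
    (e' : {i // S' i} ≃ Fin k') (ez : {i // ¬ S i ∧ ¬ S' i} ≃ Fin z) :
    relativeSum S S' p g r h = pairing F z (skew z r g) (skew z p h) := by
  let A := {i // S i}
  let B := {i // S' i}
  let C := {i // ¬ S i ∧ ¬ S' i}
  have hAB : ∀ (a : A) (b : B), a.1 ≠ b.1 := fun a b hab => hd a.1 ⟨a.2, hab ▸ b.2⟩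
  have hAC : ∀ (a : A) (c : C), a.1 ≠ c.1 := fun a c hac => c.2.1 (hac ▸ a.2)
  have hBC : ∀ (b : B) (c : C), b.1 ≠ c.1 := fun b c hbc => c.2.2 (hbc ▸ b.2)
  let t : A ⊕ (B ⊕ C) ≃ ι := Equiv.ofBijective
    (Sum.elim Subtype.val (Sum.elim Subtype.val Subtype.val)) (by
      constructor
      · rintro (a | b | c) (a' | b' | c') h <;> simp only [Sum.elim_inl, Sum.elim_inr] at h
        · rw [Subtype.ext h]
        · exact absurd h (hAB _ _)
        · exact absurd h (hAC _ _)
        · exact absurd h.symm (hAB _ _)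
        · rw [Subtype.ext h]
        · exact absurd h (hBC _ _)
        · exact absurd h.symm (hAC _ _)
        · exact absurd h.symm (hBC _ _)
        · rw [Subtype.ext h]
      · intro i
        by_cases hi : S i
        · exact ⟨Sum.inl ⟨i, hi⟩, rfl⟩
        by_cases hi' : S' i
        · exact ⟨Sum.inr (Sum.inl ⟨i, hi'⟩), rfl⟩
        · exact ⟨Sum.inr (Sum.inr ⟨i, hi, hi'⟩), rfl⟩)
  have tA : ∀ a : A, t.symm a.1 = Sum.inl a := fun a => by rw [Equiv.symm_apply_eq]; rfl
  have tB : ∀ b : B, t.symm b.1 = Sum.inr (Sum.inl b) := fun b => by rw [Equiv.symm_apply_eq]; rfl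
  have tC : ∀ c : C, t.symm c.1 = Sum.inr (Sum.inr c) := fun c => by rw [Equiv.symm_apply_eq]; rfl
  let t₁ : B ⊕ C ≃ {i // ¬ S i} :=
    { toFun := Sum.elim (fun b => ⟨b.1, fun h => hd _ ⟨h, b.2⟩⟩) (fun c => ⟨c.1, c.2.1⟩)
      invFun := fun i => if hi : S' i.1 then Sum.inl ⟨i.1, hi⟩ else Sum.inr ⟨i.1, i.2, hi⟩
      left_inv := by
        rintro (⟨a, ha⟩ | ⟨b, hb⟩)
        · simp [ha]
        · simp [hb]
      right_inv := fun i => by by_cases hi : S' i.1 <;> simp [hi] }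
  let t₂ : A ⊕ C ≃ {i // ¬ S' i} :=
    { toFun := Sum.elim (fun b => ⟨b.1, fun h => hd _ ⟨b.2, h⟩⟩) (fun c => ⟨c.1, c.2.2⟩)
      invFun := fun i => if hi : S i.1 then Sum.inl ⟨i.1, hi⟩ else Sum.inr ⟨i.1, hi, i.2⟩
      left_inv := by
        rintro (⟨a, ha⟩ | ⟨b, hb⟩)
        · simp [ha]
        · simp [hb]
      right_inv := fun i => by by_cases hi : S i.1 <;> simp [hi] }
  have key : relativeSum S S' p g r h = ∑ q : Matrix C C F × (Matrix B B F × Matrix B C F) ×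
      (Matrix A A F × Matrix A C F), (ev r q.2.1.1 * ev g (fromBlocks q.2.1.1 q.2.1.2 0 q.1)) *
        (ev p q.2.2.1 * ev h (fromBlocks q.2.2.1 q.2.2.2 0 q.1)) := by
    rw [relativeSum, ← Finset.sum_filter]
    symm
    refine Finset.sum_nbij' (fun q => (fromBlocks q.2.2.1 (fromCols 0 q.2.2.2) 0
        (fromBlocks q.2.1.1 q.2.1.2 0 q.1)).submatrix t.symm t.symm)
      (fun x => (x.submatrix Subtype.val Subtype.val,
        (x.submatrix Subtype.val Subtype.val, x.submatrix Subtype.val Subtype.val),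
        (x.submatrix Subtype.val Subtype.val, x.submatrix Subtype.val Subtype.val)))
      ?_ ?_ ?_ ?_ ?_
    · rintro ⟨d, ⟨c, u⟩, b, v⟩ -
      rw [Finset.mem_filter]
      refine ⟨Finset.mem_univ _, fun i j hi hj => ?_, fun i j hi hj => ?_⟩
      · lift j to A using hj
        obtain ⟨i, rfl⟩ := t.surjective i
        rcases i with i | i | i
        · exact absurd i.2 hi
        · simp [tA]
        · simp [tA]
      · lift j to B using hj
        obtain ⟨i, rfl⟩ := t.surjective i
        rcases i with i | i | i
        · simp [tB]
        · exact absurd i.2 hi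
        · simp [tB]
    · intro _ _; exact Finset.mem_univ _
    · rintro ⟨d, ⟨c, u⟩, b, v⟩ -
      simp only [Prod.mk.injEq]
      refine ⟨?_, ⟨?_, ?_⟩, ?_, ?_⟩ <;> ext i j <;> simp [tA, tB, tC]
    · intro x hx
      rw [Finset.mem_filter] at hx
      ext i j
      obtain ⟨i, rfl⟩ := t.surjective i
      obtain ⟨j, rfl⟩ := t.surjective j
      rcases i with i | i | i <;> rcases j with j | j | j <;>
        simp only [submatrix_apply, Equiv.symm_apply_apply, fromBlocks_apply₁₁,
          fromBlocks_apply₁₂, fromBlocks_apply₂₁, fromBlocks_apply₂₂, fromCols_apply_inl,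
          fromCols_apply_inr, Matrix.zero_apply]
      · rfl
      · exact (hx.2.2 _ _ (fun h => hd _ ⟨i.2, h⟩) j.2).symm
      · rfl
      · exact (hx.2.1 _ _ (fun h => hd _ ⟨h, i.2⟩) j.2).symm
      · rfl
      · rfl
      · exact (hx.2.1 _ _ i.2.1 j.2).symm
      · exact (hx.2.2 _ _ i.2.2 j.2).symm
      · rfl
    · rintro ⟨d, ⟨c, u⟩, b, v⟩ -
      set x := (fromBlocks b (fromCols 0 v) 0 (fromBlocks c u 0 d)).submatrix t.symm t.symm with hx
      have h1 : x.toBlock S S = b := by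
        ext i j; simp [hx, toBlock_apply, tA i, tA j]
      have h2 : x.toBlock S' S' = c := by
        ext i j; simp [hx, toBlock_apply, tB i, tB j]
      have h3 : (x.toBlock (fun i => ¬ S i) fun i => ¬ S i).submatrix t₁ t₁ =
          fromBlocks c u 0 d := by
        ext i j
        rcases i with i | i <;> rcases j with j | j <;> simp [hx, toBlock_apply, t₁, tB, tC]
      have h4 : (x.toBlock (fun i => ¬ S' i) fun i => ¬ S' i).submatrix t₂ t₂ =
          fromBlocks b v 0 d := by
        ext i j
        rcases i with i | i <;> rcases j with j | j <;> simp [hx, toBlock_apply, t₂, tA, tC]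
      simp only [h1, h2]
      rw [← ev_submatrix g t₁, ← ev_submatrix h t₂, h3, h4]
      ring
  rw [key, pairing_eq_sum_ev _ _ ez, Fintype.sum_prod_type]
  refine Finset.sum_congr rfl fun d _ => ?_
  rw [ev_skew e' ez, ev_skew e ez, Fintype.sum_prod_type]
  simp only [← Fintype.sum_prod_type', Finset.sum_mul_sum]
  convert rfl

end InvFun

/-! ### Orthogonality of even and odd words -/

namespace InvFun

open Matrix

variable {F : Type*} [Field F] [Fintype F] {n k l k' l' : ℕ}

/-- Either S and S' are disjoint, or they coincide, or their nonempty intersection is proper in one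
of them. Cuspidality handles the last case; the two hypotheses on pairings handle the others. -/
theorem relativeSum_eq_zero {S S' : Fin n → Prop} (hn : k + l = n) (hn' : k' + l' = n)
    {p : InvFun F k} (hp : IsPreCuspidal p) {g : InvFun F l} {r : InvFun F k'} (hr : IsPreCuspidal r) {h : InvFun F l'}
    (e : {i // S i} ≃ Fin k) (e' : {i // S' i} ≃ Fin k')
    (hgh : ∀ e : l' = l, pairing F l g (e ▸ h) = 0)
    (hskew : ∀ z, k' + z = l → k + z = l' → pairing F z (skew z r g) (skew z p h) = 0) :
    relativeSum S S' p g r h = 0 := by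
  have hS : Fintype.card {i // S i} = k := by rw [Fintype.card_congr e, Fintype.card_fin]
  have hS' : Fintype.card {i // S' i} = k' := by rw [Fintype.card_congr e', Fintype.card_fin]
  by_cases hA : ∃ i, S i ∧ S' i
  · by_cases h1 : ∃ i, S i ∧ ¬ S' i
    · exact relativeSum_eq_zero_of_inter hp g r h e hA h1
    by_cases h2 : ∃ i, S' i ∧ ¬ S i
    · rw [relativeSum_comm]
      exact relativeSum_eq_zero_of_inter hr h p g e' (hA.imp fun i => And.symm) h2
    push Not at h1 h2
    obtain rfl : S = S' := funext fun i => propext ⟨h1 i, h2 i⟩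
    obtain rfl : k = k' := by rw [← hS, ← hS']
    obtain rfl : l' = l := by omega
    refine relativeSum_self_eq_zero p r (Fintype.equivFinOfCardEq ?_) (hgh rfl)
    rw [Fintype.card_subtype_compl, hS, Fintype.card_fin]; omega
  · have hd : ∀ i, ¬ (S i ∧ S' i) := fun i hi => hA ⟨i, hi⟩
    have hc := Fintype.card_subtype_or_disjoint S S' (Pi.disjoint_iff.2 fun i =>
      Prop.disjoint_iff.2 (by simpa using hd i))
    have hc' := Fintype.card_subtype_compl fun i => S i ∨ S' i
    have hle := Fintype.card_subtype_le fun i => S i ∨ S' i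
    rw [hc, hS, hS', Fintype.card_fin] at hc' hle
    rw [relativeSum_of_disjoint (z := n - (k + k')) hd p g r h e e'
      (Fintype.equivFinOfCardEq ?_)]
    · exact hskew _ (by omega) (by omega)
    · rw [← hc']
      exact Fintype.card_congr (Equiv.subtypeEquivRight fun i => not_or.symm)

/-- The pairing of two products vanishes as soon as all contributions of pairs of coordinate
subspaces do. -/
theorem pairing_hcProd_hcProd_eq_zero (hn : k + l = n) (hn' : k' + l' = n) {p : InvFun F k}
    {g : InvFun F l} {r : InvFun F k'} {h : InvFun F l'}
    (H : ∀ S S' : Fin n → Prop, ({i // S i} ≃ Fin k) → ({i // S' i} ≃ Fin k') →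
      relativeSum S S' p g r h = 0) :
    pairing F n (hcProd hn p g) (hcProd hn' r h) = 0 := by
  obtain ⟨c, -, hc⟩ := exists_pairing_hcProd F hn
  obtain ⟨c', -, hc'⟩ := exists_hcProd_apply F hn'
  set S := firstIndices n k
  set S' := firstIndices n k'
  rw [hc]
  refine mul_eq_zero_of_right _ ?_
  have key : ∀ γ : GL (Fin n) F, ∑ x, (if x ∈ blockUpper F S then
      (ev p (x.toBlock S S) * ev g (x.toBlock (fun i => ¬ S i) fun i => ¬ S i)) *
      (if γ.val * x * γ⁻¹.val ∈ blockUpper F S' then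
        ev r ((γ.val * x * γ⁻¹.val).toBlock S' S') *
        ev h ((γ.val * x * γ⁻¹.val).toBlock (fun i => ¬ S' i) fun i => ¬ S' i) else 0)
      else 0) = 0 := by
    intro γ
    -- The factor `b` is absorbed by substituting in the sum over `x`, where the first integrand is
    -- invariant, and `q` by the invariance of the second integrand. What remains of `γ` is the
    -- permutation, which replaces `S'` by its image `S''`.
    obtain ⟨b, q, τ, hb, hq, hγ⟩ := exists_bruhat_decomposition S S' γ
    let S'' : Fin n → Prop := fun i => S' (τ.symm i)
    let t : {i // S' i} ≃ {i // S'' i} := τ.subtypeEquiv fun i => by simp [S'']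
    let t' : {i // ¬ S' i} ≃ {i // ¬ S'' i} := τ.subtypeEquiv fun i => by simp [S'']
    refine Eq.trans ?_ (H S S'' (firstIndicesEquiv hn) (t.symm.trans (firstIndicesEquiv hn')))
    let E : Matrix (Fin n) (Fin n) F ≃ Matrix (Fin n) (Fin n) F :=
      { toFun := fun x => b.val * x * b⁻¹.val
        invFun := fun x => b⁻¹.val * x * b.val
        left_inv := fun x => by simp [mul_assoc]
        right_inv := fun x => by simp [mul_assoc] }
    refine Fintype.sum_equiv E _ _ fun x => ?_
    change _ = if b.val * x * b⁻¹.val ∈ _ ∧ b.val * x * b⁻¹.val ∈ _ then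
      (ev p ((b.val * x * b⁻¹.val).toBlock S S) *
        ev g ((b.val * x * b⁻¹.val).toBlock (fun i => ¬ S i) fun i => ¬ S i)) *
      (ev r ((b.val * x * b⁻¹.val).toBlock S'' S'') *
        ev h ((b.val * x * b⁻¹.val).toBlock (fun i => ¬ S'' i) fun i => ¬ S'' i)) else 0
    simp only [conj_mem_blockUpper_iff hb, hγ, conj_mem_blockUpper_iff hq]
    by_cases hx : x ∈ blockUpper F S
    · have hmem : (b.val * x * b⁻¹.val).submatrix τ τ ∈ blockUpper F S' ↔
          b.val * x * b⁻¹.val ∈ blockUpper F S'' := by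
        constructor
        · intro h i j hi hj
          simpa using h (τ.symm i) (τ.symm j) hi hj
        · intro h i j hi hj
          exact h (τ i) (τ j) (by simpa [S''] using hi) (by simpa [S''] using hj)
      rw [if_pos hx, ev_toBlock_conj p hb hx, ev_toBlock_compl_conj g hb hx]
      simp only [hmem, hx, true_and]
      split_ifs with hx'
      · rw [ev_toBlock_conj r hq (hmem.2 hx'), ev_toBlock_compl_conj h hq (hmem.2 hx')]
        rw [← ev_submatrix r t, ← ev_submatrix h t']
        rfl
      · rw [mul_zero]
    · simp [hx]
  simp only [hc', mul_left_comm _ c', Finset.mul_sum]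
  calc _ = ∑ x, ∑ γ : GL (Fin n) F, c' * (if x ∈ blockUpper F S then
      (ev p (x.toBlock S S) * ev g (x.toBlock (fun i => ¬ S i) fun i => ¬ S i)) *
      (if γ.val * x * γ⁻¹.val ∈ blockUpper F S' then
        ev r ((γ.val * x * γ⁻¹.val).toBlock S' S') *
        ev h ((γ.val * x * γ⁻¹.val).toBlock (fun i => ¬ S' i) fun i => ¬ S' i) else 0)
      else 0) := by
        refine Finset.sum_congr rfl fun x _ => ?_
        by_cases hx : x ∈ blockUpper F S
        · simp only [if_pos hx]
        · simp only [if_neg hx, mul_zero, Finset.sum_const_zero]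
    _ = 0 := by
        rw [Finset.sum_comm]
        refine Finset.sum_eq_zero fun γ _ => ?_
        rw [← Finset.mul_sum, key, mul_zero]

theorem SignedWord.cases_eq {s : ℤˣ} {f : InvFun F n} (hf : SignedWord F n s f) :
    (n = 0 ∧ s = 1) ∨ ∃ (k l : ℕ) (h : k + l = n) (p : InvFun F k) (t : ℤˣ) (g : InvFun F l),
      0 < k ∧ IsPreCuspidal p ∧ s = -t ∧ SignedWord F l t g ∧ f = hcProd h p g := by
  cases hf with
  | unit f => exact Or.inl ⟨rfl, rfl⟩
  | cons h hk hp hg => exact Or.inr ⟨_, _, h, _, _, _, hk, hp, rfl, hg, rfl⟩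

theorem neg_unit_ne_self (s : ℤˣ) : -s ≠ s := by
  rcases Int.units_eq_one_or s with rfl | rfl <;> decide

theorem signPart_sup_neg (F : Type*) [Field F] [Fintype F] (n : ℕ) (s : ℤˣ) :
    signPart F n s ⊔ signPart F n (-s) = ⊤ := by
  rcases Int.units_eq_one_or s with rfl | rfl
  · exact signPart_sup F n
  · rw [neg_neg, sup_comm]; exact signPart_sup F n

/-- Write `φ = a + b` along the two signs. Testing against the conjugate of `a` removes `b` by
orthogonality and leaves ∑ |a|² = 0. -/
theorem mem_signPart_of_pairing_eq_zero
    (horth : ∀ s, ∀ f ∈ signPart F n s, ∀ g ∈ signPart F n (-s), pairing F n f g = 0)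
    {s : ℤˣ} {φ : InvFun F n} (hφ : ∀ f ∈ signPart F n s, pairing F n f φ = 0) :
    φ ∈ signPart F n (-s) := by
  have h1 : φ ∈ signPart F n s ⊔ signPart F n (-s) := by rw [signPart_sup_neg]; trivial
  obtain ⟨a, ha, b, hb, rfl⟩ := Submodule.mem_sup.1 h1
  have h2 := hφ (conj a) (conj_mem_signPart ha)
  rw [map_add, horth s _ (conj_mem_signPart ha) b hb, add_zero, pairing_comm] at h2
  rw [eq_zero_of_pairing_conj a h2, zero_add]
  exact hb

theorem pairing_signPart_eq_zero (n : ℕ) :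
    ∀ s, ∀ f ∈ signPart F n s, ∀ g ∈ signPart F n (-s), pairing F n f g = 0 := by
  induction n using Nat.strong_induction_on with
  | _ n ih =>
    -- Multiplication by the letter `r` reverses the sign, so its adjoint `skew` does too. This uses
    -- orthogonality in degrees `z` and `l`, both below `n`.
    have hskew : ∀ {k l z : ℕ} {r : InvFun F k} {g : InvFun F l} {s : ℤˣ}, 0 < k →
        IsPreCuspidal r → l < n → k + z = l → g ∈ signPart F l s →
        skew z r g ∈ signPart F z (-s) := by
      intro k l z r g s hk hr hl hz hg
      refine mem_signPart_of_pairing_eq_zero (ih z (by omega)) fun f hf => ?_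
      obtain ⟨c, hc, H⟩ := exists_pairing_skew F hz
      have h1 := ih l hl (-s) _ (hcProd_mem_signPart_neg hz hk hr hf) g (by rwa [neg_neg])
      rw [H] at h1
      exact (mul_eq_zero.1 h1).resolve_left hc
    have hword : ∀ s f g, SignedWord F n s f → SignedWord F n (-s) g → pairing F n f g = 0 := by
      intro s f₁ f₂ h₁ h₂
      rcases h₁.cases_eq with ⟨h0, hs⟩ | ⟨k, l, hn, p, t, g, hk, hp, ht, hg, rfl⟩
      · rcases h₂.cases_eq with ⟨-, hs'⟩ | ⟨k, l, hn, -, -, -, hk, -⟩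
        · exact absurd (hs'.trans hs.symm) (neg_unit_ne_self s)
        · omega
      rcases h₂.cases_eq with ⟨h0, -⟩ | ⟨k', l', hn', r, t', h, hk', hr, ht', hh, rfl⟩
      · omega
      -- Removing the first letter from both words keeps the tails `g` and `h` of opposite sign, so
      -- the case S = S' falls to the induction hypothesis.
      obtain rfl : t' = -t := by rw [ht, neg_neg] at ht'; rw [ht', neg_neg]
      refine pairing_hcProd_hcProd_eq_zero hn hn' fun S S' e e' =>
        relativeSum_eq_zero hn hn' hp hr e e' ?_ ?_
      · rintro rfl
        exact ih _ (by omega) t _ (Submodule.subset_span hg) _ (Submodule.subset_span hh)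
      · intro z hz hz'
        exact ih z (by omega) (-t) _
          (hskew hk' hr (by omega) hz (Submodule.subset_span hg)) _
          (hskew hk hp (by omega) hz' (Submodule.subset_span hh))
    intro s f hf g hg
    have h1 : ∀ f, SignedWord F n s f → pairing F n f g = 0 := fun f hf =>
      (Submodule.span_le.2 (fun g hg => hword s f g hf hg) :
        signPart F n (-s) ≤ LinearMap.ker (pairing F n f)) hg
    have h2 : signPart F n s ≤ LinearMap.ker ((pairing F n).flip g) :=
      Submodule.span_le.2 fun f hf => h1 f hf
    exact h2 hf

theorem isCompl_signPart (F : Type*) [Field F] [Fintype F] (n : ℕ) :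
    IsCompl (signPart F n 1) (signPart F n (-1)) := by
  refine ⟨Submodule.disjoint_def.2 fun f hf hf' => eq_zero_of_pairing_conj f ?_,
    codisjoint_iff.2 (signPart_sup F n)⟩
  exact pairing_signPart_eq_zero n 1 f hf _ (conj_mem_signPart hf')

/-! ### The duality operator -/

/-- The duality operator: `(-1) ^ n * s` on the span of the words of sign `s`. -/
noncomputable def duality (F : Type*) [Field F] [Fintype F] (n : ℕ) :
    InvFun F n →ₗ[ℂ] InvFun F n :=
  -- The factor `(-1) ^ n` is multiplicative in the degree and turns the sign -1 of a one-letter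
  -- word into `(-1) ^ (n - 1)`.
  (-1 : ℂ) ^ n • LinearMap.ofIsCompl (isCompl_signPart F n) (signPart F n 1).subtype
    (-(signPart F n (-1)).subtype)

theorem duality_apply_of_mem {s : ℤˣ} {f : InvFun F n} (hf : f ∈ signPart F n s) :
    duality F n f = ((-1 : ℂ) ^ n * ((s : ℤ) : ℂ)) • f := by
  rw [duality, LinearMap.smul_apply, mul_smul]
  congr 1
  rcases Int.units_eq_one_or s with rfl | rfl
  · have := LinearMap.ofIsCompl_apply_left (isCompl_signPart F n) (φ := (signPart F n 1).subtype)
      (ψ := -(signPart F n (-1)).subtype) ⟨f, hf⟩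
    rw [this]; simp
  · have := LinearMap.ofIsCompl_apply_right (isCompl_signPart F n) (φ := (signPart F n 1).subtype)
      (ψ := -(signPart F n (-1)).subtype) ⟨f, hf⟩
    rw [this]; simp

theorem duality_zero : duality F 0 = LinearMap.id := by
  ext1 f
  rw [duality_apply_of_mem (Submodule.subset_span (.unit f))]
  simp

theorem duality_of_isPreCuspidal (hn : 0 < n) {f : InvFun F n} (hf : IsPreCuspidal f) :
    duality F n f = (-1 : ℂ) ^ (n - 1) • f := by
  rw [duality_apply_of_mem (mem_signPart_of_isPreCuspidal hn hf)]
  obtain ⟨m, rfl⟩ : ∃ m, n = m + 1 := ⟨n - 1, by omega⟩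
  congr 1
  simp [pow_succ]

theorem duality_hcProd (h : k + l = n) (f : InvFun F k) (g : InvFun F l) :
    duality F n (hcProd h f g) = hcProd h (duality F k f) (duality F l g) := by
  have key : ∀ {s t : ℤˣ} {f : InvFun F k} {g : InvFun F l}, f ∈ signPart F k s →
      g ∈ signPart F l t →
      duality F n (hcProd h f g) = hcProd h (duality F k f) (duality F l g) := by
    intro s t f g hf hg
    rw [duality_apply_of_mem hf, duality_apply_of_mem hg,
      duality_apply_of_mem (hcProd_mem_signPart h hf hg), map_smul, map_smul,
      LinearMap.smul_apply, smul_smul]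
    congr 1
    rw [← h, pow_add, Units.val_mul, Int.cast_mul]
    ring
  have h₁ : f ∈ signPart F k 1 ⊔ signPart F k (-1) := by rw [signPart_sup]; trivial
  have h₂ : g ∈ signPart F l 1 ⊔ signPart F l (-1) := by rw [signPart_sup]; trivial
  obtain ⟨a, ha, b, hb, rfl⟩ := Submodule.mem_sup.1 h₁
  obtain ⟨c, hc, d, hd, rfl⟩ := Submodule.mem_sup.1 h₂
  simp only [map_add, LinearMap.add_apply, key ha hc, key ha hd, key hb hc, key hb hd]

end InvFun

end

theorem mainTheorem2 (F : Type*) [Field F] [Fintype F] :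
    ∃! D : (n : ℕ) → (InvFun F n →ₗ[ℂ] InvFun F n),
      (D 0 = LinearMap.id ∧
        ∀ n₁ n₂ : ℕ, 0 < n₁ → 0 < n₂ → ∀ (f₁ : InvFun F n₁) (f₂ : InvFun F n₂),
          D (n₁ + n₂) (hcInd (boxProd f₁ f₂)) = hcInd (boxProd (D n₁ f₁) (D n₂ f₂))) ∧
      ∀ n : ℕ, 0 < n → ∀ f : InvFun F n, IsPreCuspidal f →
        D n f = (-1 : ℂ) ^ (n - 1) • f := by
  refine ⟨InvFun.duality F, ⟨⟨InvFun.duality_zero, fun n₁ n₂ _ _ f₁ f₂ => ?_⟩,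
    fun n hn f hf => InvFun.duality_of_isPreCuspidal hn hf⟩, ?_⟩
  · exact InvFun.duality_hcProd rfl f₁ f₂
  · rintro D ⟨⟨hD0, hDmul⟩, hDcusp⟩
    funext n
    induction n using Nat.strong_induction_on with
    | _ n ih =>
      rcases Nat.eq_zero_or_pos n with rfl | hn
      · rw [hD0, InvFun.duality_zero]
      ext1 f
      -- Uniqueness: the value on `p` is prescribed, and the value on `d` is determined by
      -- multiplicativity from strictly smaller degrees.
      obtain ⟨p, d, hp, hd, rfl⟩ := InvFun.exists_isPreCuspidal_add f
      rw [map_add, map_add, hDcusp n hn p hp, InvFun.duality_of_isPreCuspidal hn hp]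
      congr 1
      have hle : InvFun.decomposables F n ≤ LinearMap.eqLocus (D n) (InvFun.duality F n) := by
        refine Submodule.span_le.2 ?_
        rintro _ ⟨k, l, rfl, hk, hl, f₁, f₂, rfl⟩
        change D (k + l) (hcInd (boxProd f₁ f₂)) = InvFun.duality F (k + l) (hcProd rfl f₁ f₂)
        rw [hDmul k l hk hl, InvFun.duality_hcProd, ih k (by omega), ih l (by omega), hcProd_rfl]
      exact hle hd
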